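/- Let $N\ge 2$, let $U$ be a unitary operator on $\mathbb C^N\otimes\mathbb C^N$, and let $S$ be the swap gate, $S(\psi_A\otimes\psi_B)=\psi_B\otimes\psi_A$. For an operator $V$ on $\mathbb C^N\otimes\mathbb C^N$ with operator Schmidt decomposition $V=\sum_{i=1}^{N^2}\sqrt{\lambda_i}\,A_i\otimes B_i$ (where $\lambda_i\ge 0$, $\operatorname{tr}(A_iA_j^\dagger)=\operatorname{tr}(B_iB_j^\dagger)=\delta_{ij}$), put $E(V)=1-\frac1{N^4}\sum_i\lambda_i^2$, and define the gate-typicality $$g_t(V)=\frac{N^2}{N^2-1}\bigl[E(V)-E(VS)+E(S)\bigr].$$ The entangling power $e_p(V)$ is the average of the linear entropy $1-\operatorname{tr}\rho_A^2$ of the state $V(\psi_A\otimes\psi_B)$, where $\rho_A$ is its reduced density matrix on the first factor, over independent random unit vectors $\psi_A,\psi_B\in\mathbb C^N$, each distributed according to the unitarily invariant probability measure. Let $\overline{e_p}$ be the average of $e_p(V)$ over Haar-random $V\in U(N^2)$. For $n\ge 1$ let $U^{(n)}=U\,W_{n-1}\,U\cdots W_1\,U$ (so $U^{(1)}=U$),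 where $W_j=U^A_j\otimes U^B_j$ and $U^A_1,U^B_1,\dots,U^A_{n-1},U^B_{n-1}$ are independent Haar-random elements of $U(N)$, and let $\langle\,\cdot\,\rangle_W$ denote the expectation over them. Then $\overline{e_p}=\dfrac{(N-1)^2}{N^2+1}$, the random variables $e_p(U^{(n)})$ and $g_t(U^{(n)})$ are integrable, and $$\langle e_p(U^{(n)})\rangle_W=\overline{e_p}\left[1-\left(1-\frac{e_p(U)}{\overline{e_p}}\right)^n\right],\qquad \langle g_t(U^{(n)})\rangle_W=1-\bigl[1-g_t(U)\bigr]^n .$$ -/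

import Mathlib

open MeasureTheory Matrix
open scoped Kronecker

namespace BipartiteGate

noncomputable section

/-! ### Haar measure on the unitary group and random pure states -/

section Haar

variable {ι : Type*} [Fintype ι] [DecidableEq ι]

/-- The unitary group carries its Borel sigma-algebra. -/
instance : MeasurableSpace (unitaryGroup ι ℂ) := borel _

instance : BorelSpace (unitaryGroup ι ℂ) := ⟨rfl⟩

instance : CompactSpace (unitaryGroup ι ℂ) := by
  have hK : IsCompact (Set.univ.pi fun _ : ι => Set.univ.pi fun _ : ι =>
      Metric.closedBall (0 : ℂ) 1) :=
    isCompact_univ_pi fun _ => isCompact_univ_pi fun _ => isCompact_closedBall _ _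
  refine isCompact_iff_compactSpace.mp
    (hK.of_isClosed_subset (isClosed_unitary (R := Matrix ι ι ℂ)) ?_)
  intro U hU i _ j _
  simpa using entry_norm_bound_of_unitary hU i j

variable (ι) in
/-- The Haar probability measure on the unitary group (the Haar measure giving the whole compact
group mass one). -/
def haarU : Measure (unitaryGroup ι ℂ) := Measure.haarMeasure ⊤

instance : IsProbabilityMeasure (haarU ι) :=
  ⟨by simpa [haarU] using Measure.haarMeasure_self (K₀ := (⊤ : TopologicalSpace.PositiveCompacts
    (unitaryGroup ι ℂ)))⟩

instance : (haarU ι).IsHaarMeasure := by unfold haarU; infer_instance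

end Haar

variable {N : ℕ}

/-- The unit vector `e₀` of `ℂ^N`. -/
def refState (N : ℕ) : Fin N → ℂ := fun i => if (i : ℕ) = 0 then 1 else 0

/-- The unitarily invariant probability measure on pure states of `ℂ^N`: the law of `u e₀`
for a Haar random unitary `u`. -/
def haarState (N : ℕ) : Measure (Fin N → ℂ) :=
  (haarU (Fin N)).map fun u : unitaryGroup (Fin N) ℂ => (u : Matrix (Fin N) (Fin N) ℂ) *ᵥ refState N

/-! ### Entangling power -/

/-- The product state `ψA ⊗ ψB`. -/
def productState (a b : Fin N → ℂ) : Fin N × Fin N → ℂ := fun p => a p.1 * b p.2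

/-- The reduced density matrix `ρ_A = tr_B |φ⟩⟨φ|`. -/
def reducedDensity (φ : Fin N × Fin N → ℂ) : Matrix (Fin N) (Fin N) ℂ :=
  Matrix.of fun i j => ∑ k, vecMulVec φ (star φ) (i, k) (j, k)

/-- Linear entropy `E_L(φ) = 1 - tr ρ_A²` of a bipartite pure state. -/
def linearEntropy (φ : Fin N × Fin N → ℂ) : ℝ :=
  1 - (trace (reducedDensity φ * reducedDensity φ)).re

/-- Entangling power: the average of `E_L(U (ψA ⊗ ψB))` over independent random
states `ψA`, `ψB`, each distributed by the unitarily invariant measure. -/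
def entanglingPower (U : Matrix (Fin N × Fin N) (Fin N × Fin N) ℂ) : ℝ :=
  ∫ ψ : (Fin N → ℂ) × (Fin N → ℂ), linearEntropy (U *ᵥ productState ψ.1 ψ.2)
    ∂(haarState N).prod (haarState N)

/-- The entangling power averaged over the Haar measure on `U(N²)`. -/
def haarMeanEntanglingPower (N : ℕ) : ℝ :=
  ∫ V : unitaryGroup (Fin N × Fin N) ℂ,
    entanglingPower (V : Matrix (Fin N × Fin N) (Fin N × Fin N) ℂ) ∂haarU (Fin N × Fin N)

/-! ### Operator Schmidt decomposition, operator entanglement, gate-typicality -/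

/-- An operator Schmidt decomposition `U = ∑ i, √(λ i) • (A i ⊗ B i)` with `N²` terms, where
`λ i ≥ 0` and `(A i)`, `(B i)` are orthonormal for the Hilbert-Schmidt inner product. -/
structure OperatorSchmidt (U : Matrix (Fin N × Fin N) (Fin N × Fin N) ℂ) where
  /-- the coefficients `λ i` -/
  coeff : Fin (N ^ 2) → ℝ
  /-- the operators on the first factor -/
  A : Fin (N ^ 2) → Matrix (Fin N) (Fin N) ℂ
  /-- the operators on the second factor -/
  B : Fin (N ^ 2) → Matrix (Fin N) (Fin N) ℂ
  coeff_nonneg : ∀ i, 0 ≤ coeff i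
  orthonormal_A : ∀ i j, trace (A i * (A j)ᴴ) = if i = j then 1 else 0
  orthonormal_B : ∀ i j, trace (B i * (B j)ᴴ) = if i = j then 1 else 0
  eq_sum : U = ∑ i, ((Real.sqrt (coeff i) : ℝ) : ℂ) • (A i ⊗ₖ B i)

/-- A singular value decomposition on a finite dimensional complex inner product space. -/
theorem exists_svd {E : Type*} [NormedAddCommGroup E] [InnerProductSpace ℂ E]
    [FiniteDimensional ℂ E] {d : ℕ} (hd : Module.finrank ℂ E = d) (T : E →ₗ[ℂ] E) :
    ∃ (l : Fin d → ℝ) (v w : OrthonormalBasis (Fin d) ℂ E),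
      (∀ k, 0 ≤ l k) ∧ ∀ k, T (v k) = ((Real.sqrt (l k) : ℝ) : ℂ) • w k := by
  have hp := T.isPositive_adjoint_comp_self
  let v := hp.isSymmetric.eigenvectorBasis hd
  let l := hp.isSymmetric.eigenvalues hd
  have hl : ∀ k, 0 ≤ l k := fun k => hp.nonneg_eigenvalues hd k
  have hin : ∀ j k, inner ℂ (T (v j)) (T (v k)) = if j = k then (l k : ℂ) else 0 := by
    intro j k
    rw [← LinearMap.adjoint_inner_right, ← LinearMap.comp_apply,
      hp.isSymmetric.apply_eigenvectorBasis hd k, inner_smul_right]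
    have := orthonormal_iff_ite.mp v.orthonormal j k
    simp only [v] at this
    rw [this]
    split_ifs <;> simp [l]
  let s : Set (Fin d) := {k | l k ≠ 0}
  let u : Fin d → E := fun k => ((Real.sqrt (l k) : ℝ) : ℂ)⁻¹ • T (v k)
  have hu : Orthonormal ℂ (s.domRestrict u) := by
    rw [orthonormal_iff_ite]
    rintro ⟨j, hj⟩ ⟨k, hk⟩
    have hk' : ((Real.sqrt (l k) : ℝ) : ℂ) ≠ 0 := by
      have : 0 < l k := lt_of_le_of_ne (hl k) (Ne.symm hk)
      exact_mod_cast (Real.sqrt_pos.mpr this).ne'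
    change inner ℂ (((Real.sqrt (l j) : ℝ) : ℂ)⁻¹ • T (v j))
      (((Real.sqrt (l k) : ℝ) : ℂ)⁻¹ • T (v k)) = _
    simp only [inner_smul_left, inner_smul_right, hin, Subtype.mk.injEq]
    split_ifs with h
    · subst h
      have h2 : ((Real.sqrt (l j) : ℝ) : ℂ) * ((Real.sqrt (l j) : ℝ) : ℂ) = (l j : ℂ) := by
        exact_mod_cast Real.mul_self_sqrt (hl j)
      rw [← h2, map_inv₀, Complex.conj_ofReal]
      field_simp
    · simp
  obtain ⟨w, hw⟩ := hu.exists_orthonormalBasis_extension_of_card_eq (by simpa using hd)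
  refine ⟨l, v, w, hl, fun k => ?_⟩
  by_cases hk : l k = 0
  · have := hin k k
    rw [if_pos rfl, hk, Complex.ofReal_zero, inner_self_eq_zero] at this
    rw [this, hk]
    simp
  · have hk' : ((Real.sqrt (l k) : ℝ) : ℂ) ≠ 0 := by
      have : 0 < l k := lt_of_le_of_ne (hl k) (Ne.symm hk)
      exact_mod_cast (Real.sqrt_pos.mpr this).ne'
    rw [hw k hk, smul_smul, mul_inv_cancel₀ hk', one_smul]

/-- Every operator on `ℂ^N ⊗ ℂ^N` has an operator Schmidt decomposition. -/
theorem nonempty_operatorSchmidt (U : Matrix (Fin N × Fin N) (Fin N × Fin N) ℂ) :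
    Nonempty (OperatorSchmidt U) := by
  let R : Matrix (Fin N × Fin N) (Fin N × Fin N) ℂ :=
    Matrix.of fun p q => U (p.1, q.1) (p.2, q.2)
  have hd : Module.finrank ℂ (EuclideanSpace ℂ (Fin N × Fin N)) = N ^ 2 := by simp [sq]
  obtain ⟨l, v, w, hl, h⟩ := exists_svd hd (Matrix.toEuclideanLin R)
  have hR : ∀ p q, R p q = ∑ k, ((Real.sqrt (l k) : ℝ) : ℂ) * w k p * star (v k q) := by
    intro p q
    have h1 : (Matrix.toEuclideanLin R (EuclideanSpace.single q 1)) p = R p q := by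
      simp [Matrix.toLpLin_apply]
    have h2 := v.sum_repr' (EuclideanSpace.single q (1 : ℂ))
    rw [← h1, ← h2, map_sum]
    simp [h, EuclideanSpace.inner_single_right]
    refine Finset.sum_congr rfl fun k _ => by ring
  have horth : ∀ b : OrthonormalBasis (Fin (N ^ 2)) ℂ (EuclideanSpace ℂ (Fin N × Fin N)),
      ∀ i j, ∑ p : Fin N, ∑ q : Fin N, b i (p, q) * star (b j (p, q)) =
        if i = j then 1 else 0 := by
    intro b i j
    have := orthonormal_iff_ite.mp b.orthonormal j i
    rw [PiLp.inner_apply, Fintype.sum_prod_type] at this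
    simp only [RCLike.inner_apply] at this
    simpa [eq_comm] using this
  refine ⟨⟨l, fun k => Matrix.of fun i j => w k (i, j),
    fun k => Matrix.of fun i j => star (v k (i, j)), hl, ?_, ?_, ?_⟩⟩
  · intro i j
    simpa [Matrix.trace, Matrix.mul_apply] using horth w i j
  · intro i j
    have := congrArg star (horth v i j)
    simpa [Matrix.trace, Matrix.mul_apply, apply_ite] using this
  · ext ⟨i, a⟩ ⟨j, b⟩
    have := hR (i, j) (a, b)
    simp only [R, Matrix.of_apply] at this
    rw [this, Matrix.sum_apply]
    simp [mul_assoc]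

/-- The operator entanglement `E(U) = 1 - (1/N⁴) ∑ i, (λ i)²` for the coefficients of an operator
Schmidt decomposition of `U`. -/
def operatorEntanglement (U : Matrix (Fin N × Fin N) (Fin N × Fin N) ℂ) : ℝ :=
  1 - 1 / (N : ℝ) ^ 4 * ∑ i, (Classical.choice (nonempty_operatorSchmidt U)).coeff i ^ 2

/-- The sum of the squared coefficients is the same for all decompositions. -/
theorem OperatorSchmidt.sum_coeff_sq {U : Matrix (Fin N × Fin N) (Fin N × Fin N) ℂ}
    (D D' : OperatorSchmidt U) : ∑ i, D.coeff i ^ 2 = ∑ i, D'.coeff i ^ 2 := by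
  let R : Matrix (Fin N × Fin N) (Fin N × Fin N) ℂ :=
    Matrix.of fun p q => U (p.1, q.1) (p.2, q.2)
  have key : ∀ D : OperatorSchmidt U,
      ((∑ i, D.coeff i ^ 2 : ℝ) : ℂ) = trace (R * Rᴴ * (R * Rᴴ)) := by
    intro D
    let a : Matrix (Fin N × Fin N) (Fin (N ^ 2)) ℂ := Matrix.of fun p k => D.A k p.1 p.2
    let b : Matrix (Fin (N ^ 2)) (Fin N × Fin N) ℂ := Matrix.of fun k p => D.B k p.1 p.2
    let d : Matrix (Fin (N ^ 2)) (Fin (N ^ 2)) ℂ :=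
      Matrix.diagonal fun k => ((Real.sqrt (D.coeff k) : ℝ) : ℂ)
    have ha : aᴴ * a = 1 := by
      ext i j
      have := D.orthonormal_A j i
      simp only [Matrix.trace, Matrix.diag, Matrix.mul_apply, Matrix.conjTranspose_apply] at this
      rw [Matrix.mul_apply, Fintype.sum_prod_type, Matrix.one_apply]
      simpa [a, mul_comm, eq_comm] using this
    have hb : b * bᴴ = 1 := by
      ext i j
      have := D.orthonormal_B i j
      simp only [Matrix.trace, Matrix.diag, Matrix.mul_apply, Matrix.conjTranspose_apply] at this
      rw [Matrix.mul_apply, Fintype.sum_prod_type, Matrix.one_apply]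
      simpa [b] using this
    have hR : R = a * d * b := by
      ext p q
      have := congrFun (congrFun D.eq_sum (p.1, q.1)) (p.2, q.2)
      rw [Matrix.sum_apply] at this
      simp only [R, Matrix.of_apply, this, Matrix.mul_apply (M := a * d)]
      refine Finset.sum_congr rfl fun k _ => ?_
      simp [a, b, d, Matrix.mul_diagonal]
      ring
    have hdd : d * dᴴ = Matrix.diagonal fun k => (D.coeff k : ℂ) := by
      simp only [d, Matrix.diagonal_conjTranspose, Matrix.diagonal_mul_diagonal]
      congr 1
      ext k
      simp only [Pi.star_apply, RCLike.star_def, Complex.conj_ofReal]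
      exact_mod_cast Real.mul_self_sqrt (D.coeff_nonneg k)
    have hRR : R * Rᴴ = a * (d * dᴴ) * aᴴ := by
      rw [hR]
      simp only [Matrix.conjTranspose_mul]
      calc a * d * b * (bᴴ * (dᴴ * aᴴ)) = a * d * (b * bᴴ) * (dᴴ * aᴴ) := by
            simp only [Matrix.mul_assoc]
        _ = _ := by rw [hb]; simp only [Matrix.mul_assoc, Matrix.one_mul]
    have h4 : R * Rᴴ * (R * Rᴴ) = a * ((d * dᴴ) * (d * dᴴ) * aᴴ) := by
      rw [hRR]
      calc _ = a * (d * dᴴ) * (aᴴ * a) * ((d * dᴴ) * aᴴ) := by simp only [Matrix.mul_assoc]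
        _ = _ := by rw [ha]; simp only [Matrix.mul_assoc, Matrix.one_mul]
    rw [h4, Matrix.trace_mul_comm, Matrix.mul_assoc, ha, Matrix.mul_one, hdd,
      Matrix.diagonal_mul_diagonal, Matrix.trace_diagonal]
    push_cast
    exact Finset.sum_congr rfl fun k _ => by ring
  exact_mod_cast (key D).trans (key D').symm

/-- The operator entanglement may be computed from any operator Schmidt decomposition. -/
theorem operatorEntanglement_eq {U : Matrix (Fin N × Fin N) (Fin N × Fin N) ℂ}
    (D : OperatorSchmidt U) :
    operatorEntanglement U = 1 - 1 / (N : ℝ) ^ 4 * ∑ i, D.coeff i ^ 2 := by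
  rw [operatorEntanglement, OperatorSchmidt.sum_coeff_sq _ D]

/-- The swap gate `S (ψA ⊗ ψB) = ψB ⊗ ψA`. -/
def swapGate (N : ℕ) : Matrix (Fin N × Fin N) (Fin N × Fin N) ℂ :=
  Matrix.of fun p q => if p = q.swap then 1 else 0

/-- Gate-typicality `g_t(U) = N²/(N²-1) * (E(U) - E(US) + E(S))`. -/
def gateTypicality (U : Matrix (Fin N × Fin N) (Fin N × Fin N) ℂ) : ℝ :=
  (N : ℝ) ^ 2 / ((N : ℝ) ^ 2 - 1) * (operatorEntanglement U -
    operatorEntanglement (U * swapGate N) + operatorEntanglement (swapGate N))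

/-! ### Iterated gates interlaced with random local gates -/

/-- The local gate `uA ⊗ uB`. -/
def localGate (w : unitaryGroup (Fin N) ℂ × unitaryGroup (Fin N) ℂ) :
    Matrix (Fin N × Fin N) (Fin N × Fin N) ℂ :=
  (w.1 : Matrix (Fin N) (Fin N) ℂ) ⊗ₖ (w.2 : Matrix (Fin N) (Fin N) ℂ)

/-- The product `U W_m U ⋯ U W_1 U` with `m` interlacing local gates; `W_j` is the local
gate of `w (j - 1)`. -/
def interlaced (U : Matrix (Fin N × Fin N) (Fin N × Fin N) ℂ) :
    (m : ℕ) → (Fin m → unitaryGroup (Fin N) ℂ × unitaryGroup (Fin N) ℂ) →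
      Matrix (Fin N × Fin N) (Fin N × Fin N) ℂ
  | 0, _ => U
  | m + 1, w => U * localGate (w (Fin.last m)) * interlaced U m fun j => w j.castSucc

/-- The joint law of `m` independent pairs of independent Haar random local unitaries. -/
def localHaar (N m : ℕ) : Measure (Fin m → unitaryGroup (Fin N) ℂ × unitaryGroup (Fin N) ℂ) :=
  Measure.pi fun _ => (haarU (Fin N)).prod (haarU (Fin N))

end

end BipartiteGate

open BipartiteGate

/-! Everything is read off two copies of the system. Let `A`, `B`, `F` be the exchanges of the first
factors, of the second factors and of the whole copies (`F = A B`). The swap trick turns purities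
and sums of squared Schmidt coefficients into traces `tr (A (V ⊗ V) X (V ⊗ V)†)` with `X` in the
span of `1, A, B, F`; thus `e_p` and `g_t` are affine in these traces (`entanglingPower_eq`,
`one_sub_gateTypicality`).

Averaging conjugation over local gates lands in that span (`isLocalCombination_localTwirl`), because
the operators commuting with every `v ⊗ v` are spanned by the identity and the swap
(`exists_eq_add_swap_of_commute`). Consider conjugation by a unitary `V ⊗ V` followed by this
average, acting on the span. It preserves the trace and the parity under right multiplication by
`F`. The traceless part of either parity sector is a line, spanned by `A - B` or by `A + B - κ (1 +
F)`, so the map acts there by a scalar (`localTwirl_twoCopy_eq_smul`). The scalars are `1 - g_t(V)`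
and `1 - e_p(V) / mean`. Inserting a random local gate between two unitaries multiplies the scalars
on average, and induction yields the `n`-th powers. -/

namespace BipartiteGate

noncomputable section

/-! ### Permutation operators. -/

section FunMatrix

variable {κ : Type*} [Fintype κ] [DecidableEq κ]

/-- The matrix sending the basis vector `e_q` to `e_{f q}`. -/
def funMatrix (f : κ → κ) : Matrix κ κ ℂ := Matrix.of fun p q => if p = f q then 1 else 0

theorem mul_funMatrix_apply (f : κ → κ) (M : Matrix κ κ ℂ) (p q : κ) :
    (M * funMatrix f) p q = M p (f q) := by
  simp [funMatrix, Matrix.mul_apply]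

theorem funMatrix_mul_apply {f : κ → κ} (hf : Function.Involutive f) (M : Matrix κ κ ℂ)
    (p q : κ) : (funMatrix f * M) p q = M (f p) q := by
  have h : ∀ j, (p = f j) ↔ (f p = j) := fun j =>
    ⟨fun h => by rw [h, hf], fun h => by rw [← h, hf]⟩
  simp [funMatrix, Matrix.mul_apply, h]

theorem funMatrix_mul (f g : κ → κ) : funMatrix f * funMatrix g = funMatrix (f ∘ g) := by
  ext p q
  rw [mul_funMatrix_apply]
  rfl

omit [Fintype κ] in
theorem funMatrix_id : funMatrix (id : κ → κ) = 1 := by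
  ext p q
  simp [funMatrix, Matrix.one_apply]

theorem trace_funMatrix_mul_vecMulVec {f : κ → κ} (hf : Function.Involutive f) (φ ψ : κ → ℂ) :
    trace (funMatrix f * vecMulVec φ ψ) = ∑ p, φ (f p) * ψ p := by
  simp [Matrix.trace, funMatrix_mul_apply hf, vecMulVec_apply]

end FunMatrix

/-! ### Conjugation by `V ⊗ V`. -/

section TwoCopy

variable {ι : Type*} [Fintype ι] [DecidableEq ι]

/-- Conjugation of an operator on two copies by `V ⊗ V`. -/
def twoCopy (V : Matrix ι ι ℂ) (X : Matrix (ι × ι) (ι × ι) ℂ) : Matrix (ι × ι) (ι × ι) ℂ :=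
  (V ⊗ₖ V) * X * (V ⊗ₖ V)ᴴ

omit [DecidableEq ι] in
theorem twoCopy_mul (V W : Matrix ι ι ℂ) (X : Matrix (ι × ι) (ι × ι) ℂ) :
    twoCopy (V * W) X = twoCopy V (twoCopy W X) := by
  simp only [twoCopy, mul_kronecker_mul, conjTranspose_mul, Matrix.mul_assoc]

omit [DecidableEq ι] in
theorem twoCopy_add (V : Matrix ι ι ℂ) (X Y : Matrix (ι × ι) (ι × ι) ℂ) :
    twoCopy V (X + Y) = twoCopy V X + twoCopy V Y := by
  simp only [twoCopy, Matrix.mul_add, Matrix.add_mul]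

omit [DecidableEq ι] in
theorem twoCopy_sub (V : Matrix ι ι ℂ) (X Y : Matrix (ι × ι) (ι × ι) ℂ) :
    twoCopy V (X - Y) = twoCopy V X - twoCopy V Y := by
  simp only [twoCopy, Matrix.mul_sub, Matrix.sub_mul]

omit [DecidableEq ι] in
theorem twoCopy_smul (V : Matrix ι ι ℂ) (c : ℂ) (X : Matrix (ι × ι) (ι × ι) ℂ) :
    twoCopy V (c • X) = c • twoCopy V X := by
  simp only [twoCopy, Matrix.mul_smul, Matrix.smul_mul]

omit [DecidableEq ι] in
theorem twoCopy_apply (V : Matrix ι ι ℂ) (X : Matrix (ι × ι) (ι × ι) ℂ) (p q : ι × ι) :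
    twoCopy V X p q =
      ∑ x, ∑ y, X x y * ((V ⊗ₖ V) p x * star ((V ⊗ₖ V) q y)) := by
  simp only [twoCopy, Matrix.mul_apply, Finset.sum_mul, conjTranspose_apply]
  rw [Finset.sum_comm]
  exact Finset.sum_congr rfl fun x _ => Finset.sum_congr rfl fun y _ => by ring

theorem twoCopy_single (V : Matrix ι ι ℂ) (x y p q : ι × ι) :
    twoCopy V (Matrix.single x y 1) p q = (V ⊗ₖ V) p x * star ((V ⊗ₖ V) q y) := by
  rw [twoCopy_apply, Finset.sum_eq_single x, Finset.sum_eq_single y]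
  · simp
  · intro b _ hb
    simp [hb.symm]
  · simp
  · intro b _ hb
    simp [hb.symm]
  · simp

theorem kronecker_self_mem_unitary {V : Matrix ι ι ℂ} (hV : V ∈ unitaryGroup ι ℂ) :
    V ⊗ₖ V ∈ unitaryGroup (ι × ι) ℂ :=
  Matrix.kronecker_mem_unitary hV hV

theorem twoCopy_of_commute {V : Matrix ι ι ℂ} (hV : V ∈ unitaryGroup ι ℂ)
    {X : Matrix (ι × ι) (ι × ι) ℂ} (h : Commute X (V ⊗ₖ V)) : twoCopy V X = X := by
  have := (mem_unitaryGroup_iff).mp (kronecker_self_mem_unitary hV)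
  rw [star_eq_conjTranspose] at this
  rw [twoCopy, ← h.eq, Matrix.mul_assoc, this, Matrix.mul_one]

/-- By cyclicity, pairing with an element of the commutant is conserved. These conserved traces
later determine every average. -/
theorem trace_mul_twoCopy_of_commute {V : Matrix ι ι ℂ} (hV : V ∈ unitaryGroup ι ℂ)
    {G : Matrix (ι × ι) (ι × ι) ℂ} (h : Commute G (V ⊗ₖ V)) (X : Matrix (ι × ι) (ι × ι) ℂ) :
    trace (G * twoCopy V X) = trace (G * X) := by
  have := (mem_unitaryGroup_iff').mp (kronecker_self_mem_unitary hV)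
  rw [star_eq_conjTranspose] at this
  calc trace (G * twoCopy V X) = trace ((G * (V ⊗ₖ V)) * X * (V ⊗ₖ V)ᴴ) := by
        simp only [twoCopy, Matrix.mul_assoc]
    _ = trace ((V ⊗ₖ V)ᴴ * (V ⊗ₖ V) * (G * X)) := by
        rw [h.eq, Matrix.trace_mul_comm]
        simp only [Matrix.mul_assoc]
    _ = _ := by rw [this, Matrix.one_mul]

theorem commute_swap_kronecker (V : Matrix ι ι ℂ) :
    Commute (funMatrix (Prod.swap : ι × ι → ι × ι)) (V ⊗ₖ V) := by
  ext p q
  rw [funMatrix_mul_apply Prod.swap_swap, mul_funMatrix_apply]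
  simp [mul_comm]

omit [DecidableEq ι] in
theorem continuous_twoCopy (X : Matrix (ι × ι) (ι × ι) ℂ) :
    Continuous fun V : Matrix ι ι ℂ => twoCopy V X := by
  have : Continuous fun V : Matrix ι ι ℂ => V ⊗ₖ V := by
    exact continuous_matrix fun p q =>
      (continuous_id.matrix_elem p.1 q.1).mul (continuous_id.matrix_elem p.2 q.2)
  unfold twoCopy
  exact (this.matrix_mul continuous_const).matrix_mul this.matrix_conjTranspose

omit [DecidableEq ι] in
theorem twoCopy_vecMulVec (V : Matrix ι ι ℂ) (φ : ι × ι → ℂ) :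
    twoCopy V (vecMulVec φ (star φ)) =
      vecMulVec ((V ⊗ₖ V) *ᵥ φ) (star ((V ⊗ₖ V) *ᵥ φ)) := by
  rw [twoCopy, mul_vecMulVec, vecMulVec_mul, star_mulVec]

end TwoCopy

/-! ### Averages over random unitaries. -/

section Twirl

variable {ι Ω : Type*} [Fintype ι] [DecidableEq ι] [MeasurableSpace Ω]

/-- The average of `twoCopy (u w) X` over `w`. -/
def twirl (μ : Measure Ω) (u : Ω → Matrix ι ι ℂ) (X : Matrix (ι × ι) (ι × ι) ℂ) :
    Matrix (ι × ι) (ι × ι) ℂ :=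
  Matrix.of fun p q => ∫ w, twoCopy (u w) X p q ∂μ

variable [TopologicalSpace Ω] [CompactSpace Ω] [OpensMeasurableSpace Ω]

/-- Compactness bounds the integrand; this settles the integrability questions over unitary groups
and their products. -/
theorem integrable_of_continuous_compactSpace {E : Type*} [NormedAddCommGroup E]
    [SecondCountableTopology E] (μ : Measure Ω) [IsFiniteMeasure μ] {f : Ω → E}
    (hf : Continuous f) : Integrable f μ := by
  obtain ⟨C, hC⟩ := (isCompact_range hf).isBounded.exists_norm_le
  exact Integrable.of_bound hf.aestronglyMeasurable C (.of_forall fun w => hC _ ⟨w, rfl⟩)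

omit [DecidableEq ι] in
theorem integrable_twoCopy (μ : Measure Ω) [IsFiniteMeasure μ] {u : Ω → Matrix ι ι ℂ}
    (hu : Continuous u) (X : Matrix (ι × ι) (ι × ι) ℂ) (p q : ι × ι) :
    Integrable (fun w => twoCopy (u w) X p q) μ :=
  integrable_of_continuous_compactSpace μ
    (((continuous_twoCopy X).comp hu).matrix_elem p q)

omit [DecidableEq ι] in
theorem integral_trace_mul_twoCopy (μ : Measure Ω) [IsFiniteMeasure μ] {u : Ω → Matrix ι ι ℂ}
    (hu : Continuous u) (A X : Matrix (ι × ι) (ι × ι) ℂ) :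
    ∫ w, trace (A * twoCopy (u w) X) ∂μ = trace (A * twirl μ u X) := by
  simp only [Matrix.trace, Matrix.diag, Matrix.mul_apply, twirl, Matrix.of_apply]
  have h : ∀ p q r, Integrable (fun w => A p q * twoCopy (u w) X q r) μ := fun p q r =>
    (integrable_twoCopy μ hu X q r).const_mul _
  rw [integral_finsetSum _ fun p _ => integrable_finsetSum _ fun q _ => h p q p]
  refine Finset.sum_congr rfl fun p _ => ?_
  rw [integral_finsetSum _ fun q _ => h p q p]
  exact Finset.sum_congr rfl fun q _ => integral_const_mul _ _

theorem trace_mul_twirl_of_commute (μ : Measure Ω) [IsProbabilityMeasure μ]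
    {u : Ω → Matrix ι ι ℂ} (hu : Continuous u) (hU : ∀ w, u w ∈ unitaryGroup ι ℂ)
    {G : Matrix (ι × ι) (ι × ι) ℂ} (hG : ∀ w, Commute G (u w ⊗ₖ u w))
    (X : Matrix (ι × ι) (ι × ι) ℂ) : trace (G * twirl μ u X) = trace (G * X) := by
  rw [← integral_trace_mul_twoCopy μ hu]
  simp [fun w => trace_mul_twoCopy_of_commute (hU w) (hG w) X]

theorem twoCopy_twirl (μ : Measure Ω) [IsFiniteMeasure μ] {u : Ω → Matrix ι ι ℂ}
    (hu : Continuous u) (V : Matrix ι ι ℂ) (X : Matrix (ι × ι) (ι × ι) ℂ) :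
    twoCopy V (twirl μ u X) = twirl μ (fun w => V * u w) X := by
  ext p q
  -- An entry of `twoCopy V Y` is a trace of `Y` against a fixed matrix, so it passes through the
  -- integral.
  have h1 : ∀ Y : Matrix (ι × ι) (ι × ι) ℂ, twoCopy V Y p q =
      trace (((V ⊗ₖ V)ᴴ * Matrix.single q p 1 * (V ⊗ₖ V)) * Y) := by
    intro Y
    have h2 : trace (Matrix.single q p 1 * twoCopy V Y) = twoCopy V Y p q := by
      rw [Matrix.trace_single_mul, one_smul]
    rw [← h2, twoCopy, ← Matrix.mul_assoc, Matrix.trace_mul_comm]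
    simp only [Matrix.mul_assoc]
  rw [h1, ← integral_trace_mul_twoCopy μ hu]
  simp only [← h1, twirl, twoCopy_mul, Matrix.of_apply]

end Twirl

/-! ### The commutant of all `v ⊗ v`. -/

section Commutant

variable {ι : Type*} [Fintype ι] [DecidableEq ι]

/-- Makes open sets measurable for the product sigma-algebra on families of unitaries. -/
instance : SecondCountableTopology (unitaryGroup ι ℂ) := by
  have : SecondCountableTopology (Matrix ι ι ℂ) :=
    inferInstanceAs (SecondCountableTopology (ι → ι → ℂ))
  exact TopologicalSpace.Subtype.secondCountableTopology _

theorem funMatrix_mem_unitaryGroup {f : ι → ι} (hf : Function.Involutive f) :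
    funMatrix f ∈ unitaryGroup ι ℂ := by
  have h1 : star (funMatrix f) = funMatrix f := by
    ext p q
    have h : q = f p ↔ p = f q := ⟨fun h => by rw [h, hf], fun h => by rw [h, hf]⟩
    simp [funMatrix, h, apply_ite]
  rw [mem_unitaryGroup_iff, h1, funMatrix_mul, hf.comp_self, funMatrix_id]

omit [Fintype ι] in
theorem funMatrix_kronecker (f g : ι → ι) :
    funMatrix f ⊗ₖ funMatrix g = funMatrix (Prod.map f g) := by
  ext p q
  by_cases h1 : p.1 = f q.1 <;> by_cases h2 : p.2 = g q.2 <;>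
    simp [funMatrix, Prod.ext_iff, h1, h2]

/-- A unitary with no vanishing entries on the coordinates `i`, `j`. -/
theorem exists_unitary_mixing {i j : ι} (hij : i ≠ j) :
    ∃ v ∈ unitaryGroup ι ℂ, v i i ≠ 0 ∧ v j i ≠ 0 := by
  -- A rational unit vector; its Householder reflection has the two entries `7/25` and `-24/25`.
  let w : ι → ℂ := Pi.single i (3 / 5) + Pi.single j (4 / 5)
  have hw : w ⬝ᵥ w = 1 := by
    simp only [w, dotProduct_add, dotProduct_single, Pi.add_apply, Pi.single_eq_same,
      Pi.single_eq_of_ne hij, Pi.single_eq_of_ne hij.symm]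
    norm_num
  have hs : star w = w := by
    ext k
    by_cases hi : k = i <;> by_cases hj : k = j <;> simp_all [w]
  have hv : star (1 - (2 : ℂ) • vecMulVec w w) = 1 - (2 : ℂ) • vecMulVec w w := by
    rw [star_sub, star_one, star_smul, star_eq_conjTranspose (vecMulVec w w),
      conjTranspose_vecMulVec, hs]
    simp
  have h2 : vecMulVec w w * vecMulVec w w = vecMulVec w w := by
    rw [vecMulVec_mul_vecMulVec, hw, one_smul]
  refine ⟨1 - (2 : ℂ) • vecMulVec w w, ?_, ?_, ?_⟩
  · rw [mem_unitaryGroup_iff, hv, sub_mul, mul_sub, mul_sub, smul_mul_smul_comm, h2, one_mul,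
      one_mul, mul_one]
    module
  · simp [w, vecMulVec_apply, hij]
    norm_num
  · simp [w, vecMulVec_apply, hij, hij.symm]

/-- The powers `1, I, -1` are distinct, so the product counts how many of the two propositions hold;
"and" and "or" encode that count. -/
theorem and_or_iff_of_ite_I_mul {P Q R S : Prop} [Decidable P] [Decidable Q] [Decidable R]
    [Decidable S] (h : (if P then Complex.I else 1) * (if Q then Complex.I else 1) =
      (if R then Complex.I else 1) * (if S then Complex.I else 1)) :
    (P ∧ Q ↔ R ∧ S) ∧ (P ∨ Q ↔ R ∨ S) := by
  by_cases hP : P <;> by_cases hQ : Q <;> by_cases hR : R <;> by_cases hS : S <;>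
    simp [hP, hQ, hR, hS, Complex.ext_iff] at h ⊢ <;> norm_num at h

/-- Operators commuting with all diagonal unitaries `v ⊗ v` preserve the unordered pair of
indices. -/
theorem eq_or_eq_swap_of_commute {Y : Matrix (ι × ι) (ι × ι) ℂ}
    (h : ∀ v ∈ unitaryGroup ι ℂ, Commute Y (v ⊗ₖ v)) {p q : ι × ι} (hY : Y p q ≠ 0) :
    q = p ∨ q = p.swap := by
  -- The diagonal unitary with `I` at `m` and `1` elsewhere detects how often `m` occurs in `p` and
  -- in `q`; a nonzero entry forces equal counts.
  have key : ∀ m : ι, (if q.1 = m then Complex.I else 1) * (if q.2 = m then Complex.I else 1) =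
      (if p.1 = m then Complex.I else 1) * (if p.2 = m then Complex.I else 1) := by
    intro m
    let d : ι → ℂ := fun k => if k = m then Complex.I else 1
    have hd : diagonal d ∈ unitaryGroup ι ℂ := by
      rw [mem_unitaryGroup_iff, star_eq_conjTranspose, diagonal_conjTranspose,
        diagonal_mul_diagonal, ← diagonal_one]
      congr 1
      ext k
      by_cases hk : k = m <;> simp [d, hk]
    have := congrFun (congrFun (h _ hd).eq p) q
    rw [diagonal_kronecker_diagonal, mul_diagonal, diagonal_mul, mul_comm] at this
    exact mul_right_cancel₀ hY this
  obtain ⟨i, j⟩ := p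
  obtain ⟨k, l⟩ := q
  have hi := and_or_iff_of_ite_I_mul (key i)
  have hj := and_or_iff_of_ite_I_mul (key j)
  simp only [Prod.mk.injEq, Prod.swap_prod_mk]
  grind

theorem apply_map_of_commute {Y : Matrix (ι × ι) (ι × ι) ℂ}
    (h : ∀ v ∈ unitaryGroup ι ℂ, Commute Y (v ⊗ₖ v)) (a b : ι) (p q : ι × ι) :
    Y (Prod.map (Equiv.swap a b) (Equiv.swap a b) p) q =
      Y p (Prod.map (Equiv.swap a b) (Equiv.swap a b) q) := by
  have hf : Function.Involutive (Equiv.swap a b) := fun x => Equiv.swap_apply_self a b x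
  have := congrFun (congrFun (h _ (funMatrix_mem_unitaryGroup hf)).eq p) q
  rw [funMatrix_kronecker, mul_funMatrix_apply, funMatrix_mul_apply (hf.prodMap hf)] at this
  exact this.symm

/-- Operators commuting with all `v ⊗ v` are spanned by the identity and the swap. -/
theorem exists_eq_add_swap_of_commute [Nontrivial ι] {Y : Matrix (ι × ι) (ι × ι) ℂ}
    (h : ∀ v ∈ unitaryGroup ι ℂ, Commute Y (v ⊗ₖ v)) :
    ∃ a b : ℂ, Y = a • 1 + b • funMatrix Prod.swap := by
  obtain ⟨i₀, j₀, h₀⟩ := exists_pair_ne ι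
  refine ⟨Y (i₀, j₀) (i₀, j₀), Y (i₀, j₀) (j₀, i₀), ?_⟩
  rw [← sub_eq_zero]
  -- The coefficients are read off one row, so that row of `Z` vanishes, and commutation spreads the
  -- vanishing: transpositions reach all rows `(i, j)` with `i ≠ j`, a mixing unitary reaches the
  -- rows `(i, i)`.
  set Z := Y - (Y (i₀, j₀) (i₀, j₀) • 1 + Y (i₀, j₀) (j₀, i₀) • funMatrix Prod.swap) with hZ
  have hc : ∀ v ∈ unitaryGroup ι ℂ, Commute Z (v ⊗ₖ v) := fun v hv =>
    (h v hv).sub_left (((Commute.one_left _).smul_left _).add_left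
      ((commute_swap_kronecker v).smul_left _))
  have hrow₀ : ∀ q, Z (i₀, j₀) q = 0 := by
    intro q
    by_contra hq
    rcases eq_or_eq_swap_of_commute hc hq with rfl | rfl
    · exact hq (by simp [hZ, funMatrix, h₀])
    · exact hq (by simp [hZ, funMatrix, h₀])
  have hmove : ∀ a b i j, (∀ q, Z (i, j) q = 0) →
      ∀ q, Z (Equiv.swap a b i, Equiv.swap a b j) q = 0 := by
    intro a b i j hij q
    have := apply_map_of_commute hc a b (i, j) q
    rw [hij] at this
    exact this
  have hfst : ∀ {a b : ι} (c : ι), a ≠ b → c ≠ b → (∀ q, Z (a, b) q = 0) →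
      ∀ q, Z (c, b) q = 0 := by
    intro a b c hab hcb hz
    have := hmove a c a b hz
    rwa [Equiv.swap_apply_left, Equiv.swap_apply_of_ne_of_ne hab.symm hcb.symm] at this
  have hsnd : ∀ {a b : ι} (c : ι), a ≠ b → a ≠ c → (∀ q, Z (a, b) q = 0) →
      ∀ q, Z (a, c) q = 0 := by
    intro a b c hab hac hz
    have := hmove b c a b hz
    rwa [Equiv.swap_apply_left, Equiv.swap_apply_of_ne_of_ne hab hac] at this
  have hoff : ∀ i j, i ≠ j → ∀ q, Z (i, j) q = 0 := by
    intro i j hij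
    -- Moving the first index directly to `j₀` would collide with the second one; exchanging both
    -- indices first avoids this.
    by_cases hi : i = j₀
    · have := hmove i₀ j₀ i₀ j₀ hrow₀
      rw [Equiv.swap_apply_left, Equiv.swap_apply_right, ← hi] at this
      exact hsnd j (hi ▸ h₀.symm) hij this
    · exact hsnd j hi hij (hfst i h₀ hi hrow₀)
  ext ⟨i, j⟩ q
  rw [Matrix.zero_apply]
  by_cases hij : i = j
  · subst hij
    by_contra hq
    have hq' : q = (i, i) := by
      rcases eq_or_eq_swap_of_commute hc hq with rfl | rfl <;> rfl
    subst hq'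
    obtain ⟨j, hj⟩ := exists_ne i
    obtain ⟨v, hv, h1, h2⟩ := exists_unitary_mixing hj.symm
    -- On the left this entry is zero because row `(i, j)` of `Z` vanishes; on the right only `v i i
    -- * v j i * Z (i, i) (i, i)` survives.
    have := congrFun (congrFun (hc v hv).eq (i, j)) (i, i)
    rw [Matrix.mul_apply, Matrix.mul_apply, Finset.sum_eq_zero (fun q _ => by
      rw [hoff i j hj.symm, zero_mul]), Finset.sum_eq_single (i, i)] at this
    · exact mul_ne_zero (mul_ne_zero h1 h2) hq this.symm
    · intro p _ hp
      have : Z p (i, i) = 0 := by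
        by_contra hp'
        rcases eq_or_eq_swap_of_commute hc hp' with h' | h'
        · exact hp h'.symm
        · exact hp (by rw [← Prod.swap_swap p, ← h']; rfl)
      rw [this, mul_zero]
    · simp
  · exact hoff i j hij q

theorem commute_of_twoCopy_eq {V : Matrix ι ι ℂ} (hV : V ∈ unitaryGroup ι ℂ)
    {X : Matrix (ι × ι) (ι × ι) ℂ} (h : twoCopy V X = X) : Commute X (V ⊗ₖ V) := by
  have := (mem_unitaryGroup_iff').mp (kronecker_self_mem_unitary hV)
  rw [star_eq_conjTranspose] at this
  change X * (V ⊗ₖ V) = (V ⊗ₖ V) * X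
  conv_lhs => rw [← h]
  rw [twoCopy, Matrix.mul_assoc, this, Matrix.mul_one]

/-- The Haar average of `(u ⊗ u) X (u ⊗ u)†` is spanned by the identity and the swap. -/
theorem exists_twirl_haarU_eq [Nontrivial ι] (X : Matrix (ι × ι) (ι × ι) ℂ) :
    ∃ a b : ℂ, twirl (haarU ι) (fun u => (u : Matrix ι ι ℂ)) X =
      a • 1 + b • funMatrix Prod.swap := by
  refine exists_eq_add_swap_of_commute fun v hv => commute_of_twoCopy_eq hv ?_
  rw [twoCopy_twirl _ continuous_subtype_val]
  ext p q
  -- Left invariance of Haar measure absorbs `v`.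
  exact integral_mul_left_eq_self (μ := haarU ι)
    (fun u : unitaryGroup ι ℂ => twoCopy (u : Matrix ι ι ℂ) X p q) ⟨v, hv⟩

end Commutant

/-! ### Averages over local gates. -/

section LocalTwirl

variable {N : ℕ}

/-- Exchange of the first factors of two copies of a bipartite system. -/
def swapFst (p : (Fin N × Fin N) × (Fin N × Fin N)) : (Fin N × Fin N) × (Fin N × Fin N) :=
  ((p.2.1, p.1.2), (p.1.1, p.2.2))

/-- Exchange of the second factors of two copies of a bipartite system. -/
def swapSnd (p : (Fin N × Fin N) × (Fin N × Fin N)) : (Fin N × Fin N) × (Fin N × Fin N) :=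
  ((p.1.1, p.2.2), (p.2.1, p.1.2))

variable (N) in
/-- The operator exchanging the first factors of two copies. -/
def exchFst : Matrix ((Fin N × Fin N) × (Fin N × Fin N)) ((Fin N × Fin N) × (Fin N × Fin N)) ℂ :=
  funMatrix swapFst

variable (N) in
/-- The operator exchanging the second factors of two copies. -/
def exchSnd : Matrix ((Fin N × Fin N) × (Fin N × Fin N)) ((Fin N × Fin N) × (Fin N × Fin N)) ℂ :=
  funMatrix swapSnd

variable (N) in
/-- The operator exchanging two copies. -/
def exchBoth : Matrix ((Fin N × Fin N) × (Fin N × Fin N)) ((Fin N × Fin N) × (Fin N × Fin N)) ℂ :=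
  funMatrix Prod.swap

theorem swapFst_involutive : Function.Involutive (swapFst (N := N)) := fun _ => rfl

theorem swapSnd_involutive : Function.Involutive (swapSnd (N := N)) := fun _ => rfl

theorem exchFst_mul_exchFst : exchFst N * exchFst N = 1 := by
  rw [exchFst, funMatrix_mul, swapFst_involutive.comp_self, funMatrix_id]

theorem exchSnd_mul_exchSnd : exchSnd N * exchSnd N = 1 := by
  rw [exchSnd, funMatrix_mul, swapSnd_involutive.comp_self, funMatrix_id]

theorem exchBoth_mul_exchBoth : exchBoth N * exchBoth N = 1 := by
  rw [exchBoth, funMatrix_mul, Prod.swap_swap_eq, funMatrix_id]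

theorem exchFst_mul_exchSnd : exchFst N * exchSnd N = exchBoth N := by
  rw [exchFst, exchSnd, funMatrix_mul]; rfl

theorem exchSnd_mul_exchFst : exchSnd N * exchFst N = exchBoth N := by
  rw [exchFst, exchSnd, funMatrix_mul]; rfl

theorem exchFst_mul_exchBoth : exchFst N * exchBoth N = exchSnd N := by
  rw [← exchFst_mul_exchSnd, ← Matrix.mul_assoc, exchFst_mul_exchFst, Matrix.one_mul]

theorem exchBoth_mul_exchFst : exchBoth N * exchFst N = exchSnd N := by
  rw [← exchSnd_mul_exchFst, Matrix.mul_assoc, exchFst_mul_exchFst, Matrix.mul_one]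

theorem exchSnd_mul_exchBoth : exchSnd N * exchBoth N = exchFst N := by
  rw [← exchSnd_mul_exchFst, ← Matrix.mul_assoc, exchSnd_mul_exchSnd, Matrix.one_mul]

theorem exchBoth_mul_exchSnd : exchBoth N * exchSnd N = exchFst N := by
  rw [← exchFst_mul_exchSnd, Matrix.mul_assoc, exchSnd_mul_exchSnd, Matrix.mul_one]

theorem trace_one_two_copies :
    trace (1 : Matrix ((Fin N × Fin N) × (Fin N × Fin N)) ((Fin N × Fin N) × (Fin N × Fin N)) ℂ) =
      (N : ℂ) ^ 4 := by
  rw [Matrix.trace_one]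
  simp
  ring

theorem trace_exchFst : trace (exchFst N) = (N : ℂ) ^ 3 := by
  simp only [Matrix.trace, Matrix.diag, exchFst, funMatrix, swapFst, Matrix.of_apply,
    Fintype.sum_prod_type, Prod.mk.injEq, and_true]
  simp [eq_comm]
  ring

theorem trace_exchSnd : trace (exchSnd N) = (N : ℂ) ^ 3 := by
  simp only [Matrix.trace, Matrix.diag, exchSnd, funMatrix, swapSnd, Matrix.of_apply,
    Fintype.sum_prod_type, Prod.mk.injEq, true_and]
  simp [eq_comm]
  ring

theorem trace_exchBoth : trace (exchBoth N) = (N : ℂ) ^ 2 := by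
  simp only [Matrix.trace, Matrix.diag, exchBoth, funMatrix, Matrix.of_apply]
  rw [Fintype.sum_prod_type]
  simp [Prod.ext_iff, ite_and, eq_comm, Fintype.sum_prod_type]
  ring

/-- Combinations of the four permutation operators commuting with all local gates. -/
def IsLocalCombination
    (Y : Matrix ((Fin N × Fin N) × (Fin N × Fin N)) ((Fin N × Fin N) × (Fin N × Fin N)) ℂ) :
    Prop :=
  ∃ a b c d : ℂ, Y = a • 1 + b • exchFst N + c • exchSnd N + d • exchBoth N

theorem IsLocalCombination.sub
    {Y Z : Matrix ((Fin N × Fin N) × (Fin N × Fin N)) ((Fin N × Fin N) × (Fin N × Fin N)) ℂ}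
    (hY : IsLocalCombination Y) (hZ : IsLocalCombination Z) : IsLocalCombination (Y - Z) := by
  obtain ⟨a, b, c, d, rfl⟩ := hY
  obtain ⟨a', b', c', d', rfl⟩ := hZ
  exact ⟨a - a', b - b', c - c', d - d', by module⟩

theorem IsLocalCombination.smul
    {Y : Matrix ((Fin N × Fin N) × (Fin N × Fin N)) ((Fin N × Fin N) × (Fin N × Fin N)) ℂ}
    (hY : IsLocalCombination Y) (r : ℂ) : IsLocalCombination (r • Y) := by
  obtain ⟨a, b, c, d, rfl⟩ := hY
  exact ⟨r * a, r * b, r * c, r * d, by module⟩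

/-- The Gram matrix of `1, A, B, F` is diagonalised by the four characters of `ℤ/2 × ℤ/2`, with
eigenvalues `N²(N+1)²`, `N²(N²-1)` (twice) and `N²(N-1)²`, all nonzero. The facts `e1` to `e4` are
the four character components. -/
theorem IsLocalCombination.eq_of_trace_eq (hN : 2 ≤ N)
    {Y Z : Matrix ((Fin N × Fin N) × (Fin N × Fin N)) ((Fin N × Fin N) × (Fin N × Fin N)) ℂ}
    (hY : IsLocalCombination Y) (hZ : IsLocalCombination Z) (h1 : trace Y = trace Z)
    (hA : trace (exchFst N * Y) = trace (exchFst N * Z))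
    (hB : trace (exchSnd N * Y) = trace (exchSnd N * Z))
    (hF : trace (exchBoth N * Y) = trace (exchBoth N * Z)) : Y = Z := by
  rw [← sub_eq_zero] at h1 hA hB hF ⊢
  rw [← trace_sub, ← Matrix.mul_sub] at hA hB hF
  rw [← trace_sub] at h1
  obtain ⟨a, b, c, d, h⟩ := hY.sub hZ
  rw [h] at h1 hA hB hF ⊢
  simp only [Matrix.mul_add, Matrix.mul_smul, trace_add, trace_smul, Matrix.mul_one, smul_eq_mul,
    exchFst_mul_exchFst, exchFst_mul_exchSnd, exchFst_mul_exchBoth,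
    exchSnd_mul_exchFst, exchSnd_mul_exchSnd, exchSnd_mul_exchBoth,
    exchBoth_mul_exchFst, exchBoth_mul_exchSnd, exchBoth_mul_exchBoth,
    trace_one_two_copies, trace_exchFst, trace_exchSnd, trace_exchBoth] at h1 hA hB hF
  have n0 : (N : ℂ) ≠ 0 := by exact_mod_cast (by omega : N ≠ 0)
  have n1 : (N : ℂ) + 1 ≠ 0 := by exact_mod_cast (by omega : N + 1 ≠ 0)
  have n2 : (N : ℂ) - 1 ≠ 0 := sub_ne_zero.mpr (by exact_mod_cast (by omega : N ≠ 1))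
  have e1 : a + b + c + d = 0 := by
    have : ((N : ℂ) * (N + 1)) ^ 2 * (a + b + c + d) = 0 := by linear_combination h1 + hA + hB + hF
    simpa [n0, n1] using this
  have e2 : a + b - c - d = 0 := by
    have : (N : ℂ) ^ 2 * ((N + 1) * (N - 1)) * (a + b - c - d) = 0 := by
      linear_combination h1 + hA - hB - hF
    simpa [n0, n1, n2] using this
  have e3 : a - b + c - d = 0 := by
    have : (N : ℂ) ^ 2 * ((N + 1) * (N - 1)) * (a - b + c - d) = 0 := by
      linear_combination h1 - hA + hB - hF
    simpa [n0, n1, n2] using this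
  have e4 : a - b - c + d = 0 := by
    have : ((N : ℂ) * (N - 1)) ^ 2 * (a - b - c + d) = 0 := by linear_combination h1 - hA - hB + hF
    simpa [n0, n2] using this
  have ha : a = 0 := by linear_combination (e1 + e2 + e3 + e4) / 4
  have hb : b = 0 := by linear_combination (e1 + e2 - e3 - e4) / 4
  have hc : c = 0 := by linear_combination (e1 - e2 + e3 - e4) / 4
  have hd : d = 0 := by linear_combination (e1 - e2 - e3 + e4) / 4
  simp [ha, hb, hc, hd]

theorem localGate_mem_unitaryGroup (w : unitaryGroup (Fin N) ℂ × unitaryGroup (Fin N) ℂ) :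
    localGate w ∈ unitaryGroup (Fin N × Fin N) ℂ :=
  Matrix.kronecker_mem_unitary w.1.2 w.2.2

theorem continuous_localGate : Continuous (localGate (N := N)) :=
  continuous_matrix fun p q =>
    ((continuous_subtype_val.comp continuous_fst).matrix_elem p.1 q.1).mul
      ((continuous_subtype_val.comp continuous_snd).matrix_elem p.2 q.2)

theorem commute_exchFst_localGate (w : unitaryGroup (Fin N) ℂ × unitaryGroup (Fin N) ℂ) :
    Commute (exchFst N) (localGate w ⊗ₖ localGate w) := by
  ext p q
  rw [exchFst, funMatrix_mul_apply swapFst_involutive, mul_funMatrix_apply]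
  simp only [localGate, kroneckerMap_apply, swapFst]
  ring

theorem commute_exchSnd_localGate (w : unitaryGroup (Fin N) ℂ × unitaryGroup (Fin N) ℂ) :
    Commute (exchSnd N) (localGate w ⊗ₖ localGate w) := by
  ext p q
  rw [exchSnd, funMatrix_mul_apply swapSnd_involutive, mul_funMatrix_apply]
  simp only [localGate, kroneckerMap_apply, swapSnd]
  ring

/-- The average over independent local gates. -/
def localTwirl
    (X : Matrix ((Fin N × Fin N) × (Fin N × Fin N)) ((Fin N × Fin N) × (Fin N × Fin N)) ℂ) :
    Matrix ((Fin N × Fin N) × (Fin N × Fin N)) ((Fin N × Fin N) × (Fin N × Fin N)) ℂ :=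
  twirl ((haarU (Fin N)).prod (haarU (Fin N))) localGate X

theorem trace_mul_localTwirl_of_commute
    {G : Matrix ((Fin N × Fin N) × (Fin N × Fin N)) ((Fin N × Fin N) × (Fin N × Fin N)) ℂ}
    (hG : ∀ w : unitaryGroup (Fin N) ℂ × unitaryGroup (Fin N) ℂ,
      Commute G (localGate w ⊗ₖ localGate w))
    (X : Matrix ((Fin N × Fin N) × (Fin N × Fin N)) ((Fin N × Fin N) × (Fin N × Fin N)) ℂ) :
    trace (G * localTwirl X) = trace (G * X) :=
  trace_mul_twirl_of_commute _ continuous_localGate localGate_mem_unitaryGroup hG X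

theorem trace_localTwirl
    (X : Matrix ((Fin N × Fin N) × (Fin N × Fin N)) ((Fin N × Fin N) × (Fin N × Fin N)) ℂ) :
    trace (localTwirl X) = trace X := by
  simpa using trace_mul_localTwirl_of_commute (fun _ => Commute.one_left _) X

theorem isLocalCombination_localTwirl (hN : 2 ≤ N)
    (X : Matrix ((Fin N × Fin N) × (Fin N × Fin N)) ((Fin N × Fin N) × (Fin N × Fin N)) ℂ) :
    IsLocalCombination (localTwirl X) := by
  have : Nontrivial (Fin N) := Fin.nontrivial_iff_two_le.mpr hN
  choose a b h using fun x y : Fin N × Fin N => exists_twirl_haarU_eq (Matrix.single x y (1 : ℂ))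
  -- On matrix units the integrand splits into a factor for each subsystem. Independence makes the
  -- integral a product of two one-party twirls, each in the span of identity and swap.
  have hprod : ∀ p q x y : (Fin N × Fin N) × (Fin N × Fin N),
      ∫ w : unitaryGroup (Fin N) ℂ × unitaryGroup (Fin N) ℂ,
        (localGate w ⊗ₖ localGate w) p x * star ((localGate w ⊗ₖ localGate w) q y)
          ∂(haarU (Fin N)).prod (haarU (Fin N)) =
      (a (x.1.1, x.2.1) (y.1.1, y.2.1) • 1 + b (x.1.1, x.2.1) (y.1.1, y.2.1) •
          funMatrix Prod.swap : Matrix _ _ ℂ) (p.1.1, p.2.1) (q.1.1, q.2.1) *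
        (a (x.1.2, x.2.2) (y.1.2, y.2.2) • 1 + b (x.1.2, x.2.2) (y.1.2, y.2.2) •
          funMatrix Prod.swap : Matrix _ _ ℂ) (p.1.2, p.2.2) (q.1.2, q.2.2) := by
    intro p q x y
    rw [← h, ← h, twirl, twirl, Matrix.of_apply, Matrix.of_apply, ← integral_prod_mul]
    refine integral_congr_ae (.of_forall fun w => ?_)
    simp only [twoCopy_single, localGate, kroneckerMap_apply, star_mul']
    ring
  have hX : ∀ p q, localTwirl X p q = ∑ x, ∑ y, X x y *
      ∫ w : unitaryGroup (Fin N) ℂ × unitaryGroup (Fin N) ℂ,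
        (localGate w ⊗ₖ localGate w) p x * star ((localGate w ⊗ₖ localGate w) q y)
          ∂(haarU (Fin N)).prod (haarU (Fin N)) := by
    intro p q
    have hint : ∀ x y, Integrable (fun w : unitaryGroup (Fin N) ℂ × unitaryGroup (Fin N) ℂ =>
        X x y * ((localGate w ⊗ₖ localGate w) p x * star ((localGate w ⊗ₖ localGate w) q y)))
        ((haarU (Fin N)).prod (haarU (Fin N))) := by
      intro x y
      simp only [← twoCopy_single]
      exact (integrable_twoCopy _ continuous_localGate _ p q).const_mul _
    simp only [localTwirl, twirl, Matrix.of_apply, twoCopy_apply]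
    rw [integral_finsetSum _ fun x _ => integrable_finsetSum _ fun y _ => hint x y]
    refine Finset.sum_congr rfl fun x _ => ?_
    rw [integral_finsetSum _ fun y _ => hint x y]
    exact Finset.sum_congr rfl fun y _ => integral_const_mul _ _
  refine ⟨∑ x, ∑ y, X x y * (a (x.1.1, x.2.1) (y.1.1, y.2.1) * a (x.1.2, x.2.2) (y.1.2, y.2.2)),
    ∑ x, ∑ y, X x y * (b (x.1.1, x.2.1) (y.1.1, y.2.1) * a (x.1.2, x.2.2) (y.1.2, y.2.2)),
    ∑ x, ∑ y, X x y * (a (x.1.1, x.2.1) (y.1.1, y.2.1) * b (x.1.2, x.2.2) (y.1.2, y.2.2)),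
    ∑ x, ∑ y, X x y * (b (x.1.1, x.2.1) (y.1.1, y.2.1) * b (x.1.2, x.2.2) (y.1.2, y.2.2)), ?_⟩
  ext p q
  -- Regrouped by subsystem instead of by copy, the four permutation operators are the tensor
  -- products of identity and swap.
  have g1 : (1 : Matrix ((Fin N × Fin N) × (Fin N × Fin N)) _ ℂ) p q =
      (1 : Matrix (Fin N × Fin N) _ ℂ) (p.1.1, p.2.1) (q.1.1, q.2.1) *
        (1 : Matrix (Fin N × Fin N) _ ℂ) (p.1.2, p.2.2) (q.1.2, q.2.2) := by
    simp only [Matrix.one_apply, Prod.ext_iff, ite_zero_mul_ite_zero, mul_one]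
    congr 1
    exact propext (by tauto)
  have gA : exchFst N p q =
      funMatrix Prod.swap (p.1.1, p.2.1) (q.1.1, q.2.1) *
        (1 : Matrix (Fin N × Fin N) _ ℂ) (p.1.2, p.2.2) (q.1.2, q.2.2) := by
    simp only [exchFst, funMatrix, swapFst, Matrix.of_apply, Matrix.one_apply, Prod.ext_iff,
      Prod.swap, ite_zero_mul_ite_zero, mul_one]
    congr 1
    exact propext (by tauto)
  have gB : exchSnd N p q =
      (1 : Matrix (Fin N × Fin N) _ ℂ) (p.1.1, p.2.1) (q.1.1, q.2.1) *
        funMatrix Prod.swap (p.1.2, p.2.2) (q.1.2, q.2.2) := by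
    simp only [exchSnd, funMatrix, swapSnd, Matrix.of_apply, Matrix.one_apply, Prod.ext_iff,
      Prod.swap, ite_zero_mul_ite_zero, mul_one]
    congr 1
    exact propext (by tauto)
  have gF : exchBoth N p q =
      funMatrix Prod.swap (p.1.1, p.2.1) (q.1.1, q.2.1) *
        funMatrix Prod.swap (p.1.2, p.2.2) (q.1.2, q.2.2) := by
    simp only [exchBoth, funMatrix, Matrix.of_apply, Prod.ext_iff,
      Prod.swap, ite_zero_mul_ite_zero, mul_one]
    congr 1
    exact propext (by tauto)
  rw [hX]
  simp only [hprod, Matrix.add_apply, Matrix.smul_apply, smul_eq_mul, g1, gA, gB, gF,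
    Finset.sum_mul, ← Finset.sum_add_distrib]
  exact Finset.sum_congr rfl fun x _ => Finset.sum_congr rfl fun y _ => by ring

/-- A local combination that is traceless and (anti)symmetric under exchange of the copies is an
eigenvector of conjugation by a unitary followed by the local average. -/
theorem localTwirl_twoCopy_eq_smul (hN : 2 ≤ N) {ε : ℂ}
    {Z : Matrix ((Fin N × Fin N) × (Fin N × Fin N)) ((Fin N × Fin N) × (Fin N × Fin N)) ℂ}
    (hZ : IsLocalCombination Z) (hF : Z * exchBoth N = ε • Z) (h0 : trace Z = 0)
    (hA : trace (exchFst N * Z) ≠ 0) {V : Matrix (Fin N × Fin N) (Fin N × Fin N) ℂ}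
    (hV : V ∈ unitaryGroup (Fin N × Fin N) ℂ) :
    localTwirl (twoCopy V Z) =
      (trace (exchFst N * twoCopy V Z) / trace (exchFst N * Z)) • Z := by
  -- The copy swap commutes with `V ⊗ V`, so parity survives the conjugation.
  have hVF : twoCopy V Z * exchBoth N = ε • twoCopy V Z := by
    rw [← twoCopy_smul, ← hF]
    have h := (commute_swap_kronecker Vᴴ).eq
    rw [conjTranspose_kronecker V V |>.symm] at h
    simp only [twoCopy, Matrix.mul_assoc]
    rw [exchBoth, h]
  -- For fixed parity and zero trace, the pairing with `exchFst N` determines the other three; this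
  -- is why the sector is a line.
  have hB : ∀ Y : Matrix _ _ ℂ, Y * exchBoth N = ε • Y →
      trace (exchSnd N * Y) = ε * trace (exchFst N * Y) := by
    intro Y hY
    rw [← exchBoth_mul_exchFst, Matrix.mul_assoc, Matrix.trace_mul_comm, Matrix.mul_assoc, hY,
      Matrix.mul_smul, trace_smul, smul_eq_mul]
  have hT : ∀ Y : Matrix _ _ ℂ, Y * exchBoth N = ε • Y →
      trace (exchBoth N * Y) = ε * trace Y := by
    intro Y hY
    rw [Matrix.trace_mul_comm, hY, trace_smul, smul_eq_mul]
  have h1 : trace (twoCopy V Z) = 0 := by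
    have := trace_mul_twoCopy_of_commute hV (Commute.one_left _) Z
    rwa [Matrix.one_mul, Matrix.one_mul, h0] at this
  refine (isLocalCombination_localTwirl hN _).eq_of_trace_eq hN (hZ.smul _) ?_ ?_ ?_ ?_
  · rw [trace_localTwirl, h1, trace_smul, h0, smul_zero]
  · rw [trace_mul_localTwirl_of_commute commute_exchFst_localGate, Matrix.mul_smul, trace_smul,
      smul_eq_mul, div_mul_cancel₀ _ hA]
  · rw [trace_mul_localTwirl_of_commute commute_exchSnd_localGate, Matrix.mul_smul, trace_smul,
      smul_eq_mul, hB _ hVF, hB _ hF]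
    field_simp
  · rw [trace_mul_localTwirl_of_commute (G := exchBoth N) (fun w => commute_swap_kronecker _),
      Matrix.mul_smul, trace_smul, hT _ hVF, hT _ hF, h1, h0, mul_zero, smul_zero]

theorem trace_exchFst_mul_twoCopy (U : Matrix (Fin N × Fin N) (Fin N × Fin N) ℂ)
    (Y : Matrix ((Fin N × Fin N) × (Fin N × Fin N)) ((Fin N × Fin N) × (Fin N × Fin N)) ℂ) :
    trace (exchFst N * twoCopy U Y) = trace (((U ⊗ₖ U)ᴴ * exchFst N * (U ⊗ₖ U)) * Y) := by
  rw [twoCopy, ← Matrix.mul_assoc, Matrix.trace_mul_comm]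
  simp only [Matrix.mul_assoc]

theorem integral_trace_exchFst_mul_twoCopy_localGate
    (V : Matrix (Fin N × Fin N) (Fin N × Fin N) ℂ)
    (X : Matrix ((Fin N × Fin N) × (Fin N × Fin N)) ((Fin N × Fin N) × (Fin N × Fin N)) ℂ) :
    ∫ w, trace (exchFst N * twoCopy V (twoCopy (localGate w) X))
        ∂(haarU (Fin N)).prod (haarU (Fin N)) =
      trace (exchFst N * twoCopy V (localTwirl X)) := by
  simp only [trace_exchFst_mul_twoCopy]
  exact integral_trace_mul_twoCopy _ continuous_localGate _ _

/-- The gate `V` acts first on `Z`, the local average returns a multiple of `Z`, and `U` then acts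
on `Z` itself; hence the eigenvalues multiply. -/
theorem integral_trace_twoCopy_mul_localGate_mul (hN : 2 ≤ N) {ε : ℂ}
    {Z : Matrix ((Fin N × Fin N) × (Fin N × Fin N)) ((Fin N × Fin N) × (Fin N × Fin N)) ℂ}
    (hZ : IsLocalCombination Z) (hF : Z * exchBoth N = ε • Z) (h0 : trace Z = 0)
    (hA : trace (exchFst N * Z) ≠ 0) (U : Matrix (Fin N × Fin N) (Fin N × Fin N) ℂ)
    {V : Matrix (Fin N × Fin N) (Fin N × Fin N) ℂ} (hV : V ∈ unitaryGroup (Fin N × Fin N) ℂ) :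
    ∫ w, trace (exchFst N * twoCopy (U * localGate w * V) Z) / trace (exchFst N * Z)
        ∂(haarU (Fin N)).prod (haarU (Fin N)) =
      trace (exchFst N * twoCopy U Z) / trace (exchFst N * Z) *
        (trace (exchFst N * twoCopy V Z) / trace (exchFst N * Z)) := by
  rw [integral_div]
  simp only [twoCopy_mul]
  rw [integral_trace_exchFst_mul_twoCopy_localGate, localTwirl_twoCopy_eq_smul hN hZ hF h0 hA hV,
    twoCopy_smul, Matrix.mul_smul, trace_smul, smul_eq_mul]
  ring

end LocalTwirl

/-! ### Schmidt coefficients as two-copy traces. -/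

section SchmidtSum

variable {N : ℕ}

/-- The realignment of a bipartite operator, whose squared singular values are its operator Schmidt
coefficients. -/
def realign (V : Matrix (Fin N × Fin N) (Fin N × Fin N) ℂ) :
    Matrix (Fin N × Fin N) (Fin N × Fin N) ℂ :=
  Matrix.of fun p q => V (p.1, q.1) (p.2, q.2)

/-- Vectorising `A i` and `B i` makes the Schmidt decomposition a singular value decomposition `a *
d * b` of the realignment; orthonormality cancels `a` and `b` from the trace. -/
theorem OperatorSchmidt.sum_coeff_sq_eq_trace
    {V : Matrix (Fin N × Fin N) (Fin N × Fin N) ℂ} (D : OperatorSchmidt V) :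
    ((∑ i, D.coeff i ^ 2 : ℝ) : ℂ) =
      trace (realign V * (realign V)ᴴ * (realign V * (realign V)ᴴ)) := by
  set R := realign V with hRdef
  let a : Matrix (Fin N × Fin N) (Fin (N ^ 2)) ℂ := Matrix.of fun p k => D.A k p.1 p.2
  let b : Matrix (Fin (N ^ 2)) (Fin N × Fin N) ℂ := Matrix.of fun k p => D.B k p.1 p.2
  let d : Matrix (Fin (N ^ 2)) (Fin (N ^ 2)) ℂ :=
    Matrix.diagonal fun k => ((Real.sqrt (D.coeff k) : ℝ) : ℂ)
  have ha : aᴴ * a = 1 := by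
    ext i j
    have := D.orthonormal_A j i
    simp only [Matrix.trace, Matrix.diag, Matrix.mul_apply, Matrix.conjTranspose_apply] at this
    rw [Matrix.mul_apply, Fintype.sum_prod_type, Matrix.one_apply]
    simpa [a, mul_comm, eq_comm] using this
  have hb : b * bᴴ = 1 := by
    ext i j
    have := D.orthonormal_B i j
    simp only [Matrix.trace, Matrix.diag, Matrix.mul_apply, Matrix.conjTranspose_apply] at this
    rw [Matrix.mul_apply, Fintype.sum_prod_type, Matrix.one_apply]
    simpa [b] using this
  have hR : R = a * d * b := by
    ext p q
    have := congrFun (congrFun D.eq_sum (p.1, q.1)) (p.2, q.2)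
    rw [Matrix.sum_apply] at this
    simp only [hRdef, realign, Matrix.of_apply, this, Matrix.mul_apply (M := a * d)]
    refine Finset.sum_congr rfl fun k _ => ?_
    simp [a, b, d, Matrix.mul_diagonal]
    ring
  have hdd : d * dᴴ = Matrix.diagonal fun k => (D.coeff k : ℂ) := by
    simp only [d, Matrix.diagonal_conjTranspose, Matrix.diagonal_mul_diagonal]
    congr 1
    ext k
    simp only [Pi.star_apply, RCLike.star_def, Complex.conj_ofReal]
    exact_mod_cast Real.mul_self_sqrt (D.coeff_nonneg k)
  have hRR : R * Rᴴ = a * (d * dᴴ) * aᴴ := by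
    rw [hR]
    simp only [Matrix.conjTranspose_mul]
    calc a * d * b * (bᴴ * (dᴴ * aᴴ)) = a * d * (b * bᴴ) * (dᴴ * aᴴ) := by
          simp only [Matrix.mul_assoc]
      _ = _ := by rw [hb]; simp only [Matrix.mul_assoc, Matrix.one_mul]
  have h4 : R * Rᴴ * (R * Rᴴ) = a * ((d * dᴴ) * (d * dᴴ) * aᴴ) := by
    rw [hRR]
    calc _ = a * (d * dᴴ) * (aᴴ * a) * ((d * dᴴ) * aᴴ) := by simp only [Matrix.mul_assoc]
      _ = _ := by rw [ha]; simp only [Matrix.mul_assoc, Matrix.one_mul]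
  rw [h4, Matrix.trace_mul_comm, Matrix.mul_assoc, ha, Matrix.mul_one, hdd,
    Matrix.diagonal_mul_diagonal, Matrix.trace_diagonal]
  push_cast
  exact Finset.sum_congr rfl fun k _ => by ring

theorem trace_realign (V : Matrix (Fin N × Fin N) (Fin N × Fin N) ℂ) :
    trace (realign V * (realign V)ᴴ * (realign V * (realign V)ᴴ)) =
      trace (exchFst N * twoCopy V (exchFst N)) := by
  have hl : trace (realign V * (realign V)ᴴ * (realign V * (realign V)ᴴ)) =
      ∑ t : ((Fin N × Fin N) × (Fin N × Fin N)) × ((Fin N × Fin N) × (Fin N × Fin N)),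
        V (t.1.1.1, t.2.1.1) (t.1.1.2, t.2.1.2) * star (V (t.1.2.1, t.2.1.1) (t.1.2.2, t.2.1.2)) *
        (V (t.1.2.1, t.2.2.1) (t.1.2.2, t.2.2.2) *
          star (V (t.1.1.1, t.2.2.1) (t.1.1.2, t.2.2.2))) := by
    simp only [Matrix.trace, Matrix.diag, Matrix.mul_apply, conjTranspose_apply, realign,
      Matrix.of_apply, Finset.sum_mul_sum]
    simp only [Fintype.sum_prod_type]
  have hr : trace (exchFst N * twoCopy V (exchFst N)) =
      ∑ t : ((Fin N × Fin N) × (Fin N × Fin N)) × ((Fin N × Fin N) × (Fin N × Fin N)),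
        V (t.1.2.1, t.1.1.2) (t.2.2.1, t.2.1.2) * V (t.1.1.1, t.1.2.2) (t.2.1.1, t.2.2.2) *
        (star (V t.1.1 t.2.1) * star (V t.1.2 t.2.2)) := by
    rw [Fintype.sum_prod_type]
    simp only [Matrix.trace, Matrix.diag]
    refine Finset.sum_congr rfl fun p _ => ?_
    rw [exchFst, funMatrix_mul_apply swapFst_involutive, twoCopy, Matrix.mul_apply]
    refine Finset.sum_congr rfl fun x _ => ?_
    rw [mul_funMatrix_apply]
    simp only [conjTranspose_apply, kroneckerMap_apply, swapFst, star_mul']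
  rw [hl, hr]
  -- Both sides sum the same product of two entries of `V` and two conjugates over eight indices;
  -- the bijection only renames them.
  refine Fintype.sum_equiv
    { toFun := fun t => (((t.1.2.1, t.2.1.1), (t.1.1.1, t.2.2.1)),
        ((t.1.2.2, t.2.1.2), (t.1.1.2, t.2.2.2)))
      invFun := fun s => (((s.1.2.1, s.2.2.1), (s.1.1.1, s.2.1.1)),
        ((s.1.1.2, s.2.1.2), (s.1.2.2, s.2.2.2)))
      left_inv := fun _ => rfl
      right_inv := fun _ => rfl } _ _ fun t => ?_
  simp only [Equiv.coe_fn_mk]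
  ring

/-- The sum of the squared operator Schmidt coefficients. -/
def schmidtSum (V : Matrix (Fin N × Fin N) (Fin N × Fin N) ℂ) : ℝ :=
  ∑ i, (Classical.choice (nonempty_operatorSchmidt V)).coeff i ^ 2

theorem ofReal_schmidtSum (V : Matrix (Fin N × Fin N) (Fin N × Fin N) ℂ) :
    (schmidtSum V : ℂ) = trace (exchFst N * twoCopy V (exchFst N)) := by
  rw [schmidtSum, OperatorSchmidt.sum_coeff_sq_eq_trace, trace_realign]

theorem swapGate_eq_funMatrix : swapGate N = funMatrix Prod.swap := rfl

/-- Swapping the subsystems inside each copy interchanges their roles. Thus `E(VS)` pairs with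
`exchSnd N` where `E(V)` pairs with `exchFst N`. -/
theorem twoCopy_swapGate_exchFst : twoCopy (swapGate N) (exchFst N) = exchSnd N := by
  have h : (swapGate N)ᴴ = swapGate N := by
    ext p q
    simp [swapGate, apply_ite, Prod.ext_iff, eq_comm, and_comm]
  rw [twoCopy, conjTranspose_kronecker, h, swapGate_eq_funMatrix, funMatrix_kronecker, exchFst,
    funMatrix_mul, funMatrix_mul]
  rfl

theorem ofReal_schmidtSum_mul_swapGate (V : Matrix (Fin N × Fin N) (Fin N × Fin N) ℂ) :
    (schmidtSum (V * swapGate N) : ℂ) = trace (exchFst N * twoCopy V (exchSnd N)) := by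
  rw [ofReal_schmidtSum, twoCopy_mul, twoCopy_swapGate_exchFst]

theorem schmidtSum_swapGate : schmidtSum (swapGate N) = (N : ℝ) ^ 2 := by
  have := ofReal_schmidtSum (swapGate N)
  rw [twoCopy_swapGate_exchFst, exchFst_mul_exchSnd, trace_exchBoth] at this
  exact_mod_cast this

theorem continuous_schmidtSum : Continuous (schmidtSum (N := N)) := by
  -- Continuity is invisible in the definition, which chooses a decomposition for each `V`.
  have : schmidtSum (N := N) = fun V => (trace (exchFst N * twoCopy V (exchFst N))).re := by
    ext V
    rw [← ofReal_schmidtSum, Complex.ofReal_re]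
  rw [this]
  exact Complex.continuous_re.comp
    (continuous_const.matrix_mul (continuous_twoCopy _)).matrix_trace

/-- Since `E(S) = 1 - 1/N²`, the prefactor turns the `E(S)` term into `1`, which cancels. The
denominator is `tr (A (A - B))`, so this is the eigenvalue on `A - B`. -/
theorem one_sub_gateTypicality (hN : 2 ≤ N) (V : Matrix (Fin N × Fin N) (Fin N × Fin N) ℂ) :
    1 - gateTypicality V =
      (schmidtSum V - schmidtSum (V * swapGate N)) / ((N : ℝ) ^ 4 - (N : ℝ) ^ 2) := by
  have hE : ∀ W : Matrix (Fin N × Fin N) (Fin N × Fin N) ℂ,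
      operatorEntanglement W = 1 - 1 / (N : ℝ) ^ 4 * schmidtSum W := fun W => rfl
  have h2 : (2 : ℝ) ≤ N := by exact_mod_cast hN
  have h0 : (N : ℝ) ≠ 0 := by positivity
  have h1 : (N : ℝ) ^ 2 - 1 ≠ 0 := by nlinarith
  have h4 : (N : ℝ) ^ 4 - (N : ℝ) ^ 2 = (N : ℝ) ^ 2 * ((N : ℝ) ^ 2 - 1) := by ring
  rw [gateTypicality, hE, hE, hE, schmidtSum_swapGate, h4]
  field_simp
  ring

end SchmidtSum

/-! ### The swap trick for linear entropy. -/

section EntanglingPower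

variable {N : ℕ}

/-- The product vector `a ⊗ b`. -/
def tensorVec {ι κ : Type*} (a : ι → ℂ) (b : κ → ℂ) : ι × κ → ℂ := fun p => a p.1 * b p.2

theorem kronecker_mulVec_tensorVec {ι κ : Type*} [Fintype ι] [Fintype κ] (A : Matrix ι ι ℂ)
    (B : Matrix κ κ ℂ) (a : ι → ℂ) (b : κ → ℂ) :
    (A ⊗ₖ B) *ᵥ tensorVec a b = tensorVec (A *ᵥ a) (B *ᵥ b) := by
  ext p
  simp only [mulVec, dotProduct, tensorVec, kroneckerMap_apply, Fintype.sum_prod_type,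
    Finset.sum_mul_sum]
  exact Finset.sum_congr rfl fun x _ => Finset.sum_congr rfl fun y _ => by ring

/-- The projection on two copies of a vector. -/
def twoCopyState (φ : Fin N × Fin N → ℂ) :
    Matrix ((Fin N × Fin N) × (Fin N × Fin N)) ((Fin N × Fin N) × (Fin N × Fin N)) ℂ :=
  vecMulVec (tensorVec φ φ) (star (tensorVec φ φ))

theorem twoCopy_twoCopyState (V : Matrix (Fin N × Fin N) (Fin N × Fin N) ℂ)
    (φ : Fin N × Fin N → ℂ) : twoCopy V (twoCopyState φ) = twoCopyState (V *ᵥ φ) := by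
  rw [twoCopyState, twoCopy_vecMulVec, kronecker_mulVec_tensorVec, twoCopyState]

/-- The purity of `ρ_A` is the expectation of the exchange of first factors in `φ ⊗ φ`. -/
theorem linearEntropy_eq (φ : Fin N × Fin N → ℂ) :
    linearEntropy φ = 1 - (trace (exchFst N * twoCopyState φ)).re := by
  rw [linearEntropy]
  congr 2
  rw [exchFst, twoCopyState, trace_funMatrix_mul_vecMulVec swapFst_involutive]
  simp only [Matrix.trace, Matrix.diag, Matrix.mul_apply, reducedDensity, Matrix.of_apply,
    vecMulVec_apply, Finset.sum_mul_sum]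
  simp only [Fintype.sum_prod_type, tensorVec, swapFst, Pi.star_apply, star_mul']
  rw [Finset.sum_comm]
  refine Finset.sum_congr rfl fun j _ => ?_
  rw [Finset.sum_comm]
  exact Finset.sum_congr rfl fun k _ => Finset.sum_congr rfl fun i _ =>
    Finset.sum_congr rfl fun l _ => by ring

end EntanglingPower

/-! ### Entangling power as a two-copy trace, and its Haar mean. -/

section MeanEntropy

variable {N : ℕ}

variable (N) in
/-- The sum of the four permutation operators on two copies. -/
def exchSum : Matrix ((Fin N × Fin N) × (Fin N × Fin N)) ((Fin N × Fin N) × (Fin N × Fin N)) ℂ :=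
  1 + exchFst N + exchSnd N + exchBoth N

theorem isLocalCombination_exchSum : IsLocalCombination (exchSum N) :=
  ⟨1, 1, 1, 1, by simp only [exchSum, one_smul]⟩

theorem exchFst_mul_exchSum : exchFst N * exchSum N = exchSum N := by
  simp only [exchSum, Matrix.mul_add, Matrix.mul_one, exchFst_mul_exchFst, exchFst_mul_exchSnd,
    exchFst_mul_exchBoth]
  abel

theorem exchSnd_mul_exchSum : exchSnd N * exchSum N = exchSum N := by
  simp only [exchSum, Matrix.mul_add, Matrix.mul_one, exchSnd_mul_exchFst, exchSnd_mul_exchSnd,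
    exchSnd_mul_exchBoth]
  abel

theorem exchBoth_mul_exchSum : exchBoth N * exchSum N = exchSum N := by
  simp only [exchSum, Matrix.mul_add, Matrix.mul_one, exchBoth_mul_exchFst, exchBoth_mul_exchSnd,
    exchBoth_mul_exchBoth]
  abel

theorem trace_exchSum : trace (exchSum N) = (N : ℂ) ^ 2 * ((N : ℂ) + 1) ^ 2 := by
  simp only [exchSum, trace_add, trace_one_two_copies, trace_exchFst, trace_exchSnd,
    trace_exchBoth]
  ring

/-- The vector `e₀ ⊗ e₀ ⊗ e₀ ⊗ e₀` is fixed by all four permutations, so its four traces are `1`.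
The sum of the permutations absorbs each of them, so after division by its trace it has the same
four traces. -/
theorem localTwirl_twoCopyState_refState (hN : 2 ≤ N) :
    localTwirl (twoCopyState (productState (refState N) (refState N))) =
      (1 / ((N : ℂ) ^ 2 * ((N : ℂ) + 1) ^ 2)) • exchSum N := by
  let o : Fin N := ⟨0, by omega⟩
  have hr : refState N = Pi.single o 1 := by
    ext i
    simp [refState, Pi.single_apply, o, Fin.ext_iff]
  have hΨ : tensorVec (productState (refState N) (refState N))
      (productState (refState N) (refState N)) = Pi.single ((o, o), (o, o)) 1 := by
    ext ⟨⟨i, j⟩, ⟨k, l⟩⟩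
    simp only [tensorVec, productState, hr, Pi.single_apply, Prod.mk.injEq, ite_zero_mul_ite_zero,
      mul_one]
  have htr : ∀ f : (Fin N × Fin N) × (Fin N × Fin N) → _, Function.Involutive f →
      f ((o, o), (o, o)) = ((o, o), (o, o)) →
      trace (funMatrix f * twoCopyState (productState (refState N) (refState N))) = 1 := by
    intro f hf ho
    rw [twoCopyState, trace_funMatrix_mul_vecMulVec hf, hΨ, Finset.sum_eq_single ((o, o), (o, o))]
    · simp [ho]
    · intro p _ hp
      simp [hp]
    · simp
  have n0 : (N : ℂ) ≠ 0 := by exact_mod_cast (by omega : N ≠ 0)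
  have n1 : (N : ℂ) + 1 ≠ 0 := by exact_mod_cast (by omega : N + 1 ≠ 0)
  have hc : (1 / ((N : ℂ) ^ 2 * ((N : ℂ) + 1) ^ 2)) * trace (exchSum N) = 1 := by
    rw [trace_exchSum]
    field_simp
  refine (isLocalCombination_localTwirl hN _).eq_of_trace_eq hN
    (isLocalCombination_exchSum.smul _) ?_ ?_ ?_ ?_
  · rw [trace_localTwirl, trace_smul, smul_eq_mul, hc]
    have := htr id (fun _ => rfl) rfl
    rwa [funMatrix_id, Matrix.one_mul] at this
  · rw [trace_mul_localTwirl_of_commute commute_exchFst_localGate, Matrix.mul_smul, trace_smul,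
      smul_eq_mul, exchFst_mul_exchSum, hc]
    exact htr _ swapFst_involutive rfl
  · rw [trace_mul_localTwirl_of_commute commute_exchSnd_localGate, Matrix.mul_smul, trace_smul,
      smul_eq_mul, exchSnd_mul_exchSum, hc]
    exact htr _ swapSnd_involutive rfl
  · rw [trace_mul_localTwirl_of_commute (G := exchBoth N) (fun w => commute_swap_kronecker _),
      Matrix.mul_smul, trace_smul, smul_eq_mul, exchBoth_mul_exchSum, hc]
    exact htr _ Prod.swap_swap rfl

theorem continuous_trace_exchFst_mul_twoCopy
    (Y : Matrix ((Fin N × Fin N) × (Fin N × Fin N)) ((Fin N × Fin N) × (Fin N × Fin N)) ℂ) :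
    Continuous fun V => trace (exchFst N * twoCopy V Y) :=
  (continuous_const.matrix_mul (continuous_twoCopy _)).matrix_trace

theorem continuous_linearEntropy : Continuous (linearEntropy (N := N)) := by
  have h : Continuous (reducedDensity (N := N)) := by
    refine continuous_matrix fun i j => ?_
    simp only [reducedDensity, Matrix.of_apply, vecMulVec_apply, Pi.star_apply]
    fun_prop
  exact continuous_const.sub (Complex.continuous_re.comp (h.matrix_mul h).matrix_trace)

theorem entanglingPower_eq_trace (hN : 2 ≤ N) (V : Matrix (Fin N × Fin N) (Fin N × Fin N) ℂ) :
    entanglingPower V = 1 - (trace (exchFst N * twoCopy V (exchSum N)) /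
      ((N : ℂ) ^ 2 * ((N : ℂ) + 1) ^ 2)).re := by
  have hm : Continuous fun u : unitaryGroup (Fin N) ℂ =>
      (u : Matrix (Fin N) (Fin N) ℂ) *ᵥ refState N :=
    continuous_subtype_val.matrix_mulVec continuous_const
  have hcont : Continuous fun ψ : (Fin N → ℂ) × (Fin N → ℂ) =>
      linearEntropy (V *ᵥ productState ψ.1 ψ.2) := by
    refine continuous_linearEntropy.comp (continuous_const.matrix_mulVec ?_)
    unfold productState
    fun_prop
  have hint : Integrable (fun w : unitaryGroup (Fin N) ℂ × unitaryGroup (Fin N) ℂ =>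
      trace (exchFst N * twoCopy V (twoCopy (localGate w)
        (twoCopyState (productState (refState N) (refState N))))))
      ((haarU (Fin N)).prod (haarU (Fin N))) := by
    refine integrable_of_continuous_compactSpace _ ?_
    simp only [← twoCopy_mul]
    exact (continuous_trace_exchFst_mul_twoCopy _).comp
      (continuous_const.matrix_mul continuous_localGate)
  have hw : ∀ w : unitaryGroup (Fin N) ℂ × unitaryGroup (Fin N) ℂ,
      linearEntropy (V *ᵥ productState ((w.1 : Matrix (Fin N) (Fin N) ℂ) *ᵥ refState N)
        ((w.2 : Matrix (Fin N) (Fin N) ℂ) *ᵥ refState N)) =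
      1 - RCLike.re (trace (exchFst N * twoCopy V (twoCopy (localGate w)
        (twoCopyState (productState (refState N) (refState N)))))) := by
    -- A pair of random states is a random local gate applied to the reference product state.
    intro w
    have h : productState ((w.1 : Matrix (Fin N) (Fin N) ℂ) *ᵥ refState N)
        ((w.2 : Matrix (Fin N) (Fin N) ℂ) *ᵥ refState N) =
        localGate w *ᵥ productState (refState N) (refState N) :=
      (kronecker_mulVec_tensorVec _ _ _ _).symm
    rw [linearEntropy_eq, twoCopy_twoCopyState, twoCopy_twoCopyState, h]
    rfl
  rw [entanglingPower, haarState, Measure.map_prod_map _ _ hm.measurable hm.measurable,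
    integral_map (hm.measurable.prodMap hm.measurable).aemeasurable
      hcont.aestronglyMeasurable]
  simp only [Prod.map, hw]
  rw [integral_sub (integrable_const _) hint.re, integral_re hint,
    integral_trace_exchFst_mul_twoCopy_localGate, localTwirl_twoCopyState_refState hN,
    twoCopy_smul, Matrix.mul_smul, trace_smul, smul_eq_mul, one_div_mul_eq_div]
  simp

theorem continuous_entanglingPower (hN : 2 ≤ N) : Continuous (entanglingPower (N := N)) := by
  have : entanglingPower (N := N) = fun V => 1 - (trace (exchFst N * twoCopy V (exchSum N)) /
      ((N : ℂ) ^ 2 * ((N : ℂ) + 1) ^ 2)).re :=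
    funext fun V => entanglingPower_eq_trace hN V
  rw [this]
  exact continuous_const.sub (Complex.continuous_re.comp
    ((continuous_trace_exchFst_mul_twoCopy _).div_const _))

theorem twoCopy_one_of_mem {V : Matrix (Fin N × Fin N) (Fin N × Fin N) ℂ}
    (hV : V ∈ unitaryGroup (Fin N × Fin N) ℂ) : twoCopy V 1 = 1 :=
  twoCopy_of_commute hV (Commute.one_left _)

theorem twoCopy_exchBoth_of_mem {V : Matrix (Fin N × Fin N) (Fin N × Fin N) ℂ}
    (hV : V ∈ unitaryGroup (Fin N × Fin N) ℂ) : twoCopy V (exchBoth N) = exchBoth N :=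
  twoCopy_of_commute hV (commute_swap_kronecker V)

/-- Conjugation by a unitary fixes `1` and `F`, and each contributes `tr A = tr (A F) = N³`. -/
theorem entanglingPower_eq (hN : 2 ≤ N) {V : Matrix (Fin N × Fin N) (Fin N × Fin N) ℂ}
    (hV : V ∈ unitaryGroup (Fin N × Fin N) ℂ) :
    entanglingPower V = 1 - (2 * (N : ℝ) ^ 3 + schmidtSum V + schmidtSum (V * swapGate N)) /
      ((N : ℝ) ^ 2 * ((N : ℝ) + 1) ^ 2) := by
  have h : trace (exchFst N * twoCopy V (exchSum N)) / ((N : ℂ) ^ 2 * ((N : ℂ) + 1) ^ 2) =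
      (((2 * (N : ℝ) ^ 3 + schmidtSum V + schmidtSum (V * swapGate N)) /
      ((N : ℝ) ^ 2 * ((N : ℝ) + 1) ^ 2) : ℝ) : ℂ) := by
    push_cast
    rw [ofReal_schmidtSum, ofReal_schmidtSum_mul_swapGate]
    simp only [exchSum, twoCopy_add, twoCopy_one_of_mem hV, twoCopy_exchBoth_of_mem hV,
      Matrix.mul_add, trace_add, Matrix.mul_one, trace_exchFst, exchFst_mul_exchBoth,
      trace_exchSnd]
    ring
  rw [entanglingPower_eq_trace hN, h, Complex.ofReal_re]

theorem haarMeanEntanglingPower_eq (hN : 2 ≤ N) :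
    haarMeanEntanglingPower N = ((N : ℝ) - 1) ^ 2 / ((N : ℝ) ^ 2 + 1) := by
  have : Nontrivial (Fin N) := Fin.nontrivial_iff_two_le.mpr hN
  have n0 : (N : ℂ) ≠ 0 := by exact_mod_cast (by omega : N ≠ 0)
  have n1 : (N : ℂ) + 1 ≠ 0 := by exact_mod_cast (by omega : N + 1 ≠ 0)
  have n2 : (N : ℂ) ^ 2 + 1 ≠ 0 := by exact_mod_cast (by positivity : N ^ 2 + 1 ≠ 0)
  obtain ⟨a, b, hab⟩ := exists_twirl_haarU_eq (exchSum N)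
  have hu := continuous_subtype_val (p := fun V => V ∈ unitaryGroup (Fin N × Fin N) ℂ)
  have h1 := trace_mul_twirl_of_commute (haarU (Fin N × Fin N)) hu Subtype.property
    (fun w => Commute.one_left _) (exchSum N)
  have hF := trace_mul_twirl_of_commute (haarU (Fin N × Fin N)) hu Subtype.property
    (fun w => commute_swap_kronecker _) (exchSum N)
  change trace (exchBoth N * _) = trace (exchBoth N * _) at hF
  change _ = a • 1 + b • exchBoth N at hab
  rw [hab, Matrix.one_mul, Matrix.one_mul] at h1
  rw [hab, exchBoth_mul_exchSum] at hF
  simp only [Matrix.mul_add, Matrix.mul_smul, Matrix.mul_one, exchBoth_mul_exchBoth, trace_add,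
    trace_smul, smul_eq_mul, trace_one_two_copies, trace_exchBoth, trace_exchSum] at h1 hF
  -- Only `a + b` matters, because `tr A = tr (A F)`. Adding the two conserved traces, with `1` and
  -- with `F`, gives it.
  have hs : a + b = 2 * ((N : ℂ) + 1) ^ 2 / ((N : ℂ) ^ 2 + 1) := by
    field_simp
    have : (N : ℂ) ^ 2 * ((a + b) * ((N : ℂ) ^ 2 + 1)) =
        (N : ℂ) ^ 2 * (2 * ((N : ℂ) + 1) ^ 2) := by linear_combination h1 + hF
    exact mul_left_cancel₀ (pow_ne_zero 2 n0) this
  have hint : Integrable (fun V : unitaryGroup (Fin N × Fin N) ℂ =>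
      trace (exchFst N * twoCopy (V : Matrix (Fin N × Fin N) (Fin N × Fin N) ℂ) (exchSum N)) /
        ((N : ℂ) ^ 2 * ((N : ℂ) + 1) ^ 2)) (haarU (Fin N × Fin N)) :=
    integrable_of_continuous_compactSpace _
      (((continuous_trace_exchFst_mul_twoCopy _).comp hu).div_const _)
  have hmean : ∫ V : unitaryGroup (Fin N × Fin N) ℂ,
      trace (exchFst N * twoCopy (V : Matrix (Fin N × Fin N) (Fin N × Fin N) ℂ) (exchSum N)) /
        ((N : ℂ) ^ 2 * ((N : ℂ) + 1) ^ 2) ∂haarU (Fin N × Fin N) =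
      ((2 * N / ((N : ℝ) ^ 2 + 1) : ℝ) : ℂ) := by
    rw [integral_div, integral_trace_mul_twoCopy _ hu, hab]
    simp only [Matrix.mul_add, Matrix.mul_smul, Matrix.mul_one, exchFst_mul_exchBoth, trace_add,
      trace_smul, smul_eq_mul, trace_exchFst, trace_exchSnd]
    rw [← add_mul, hs]
    push_cast
    field_simp
  rw [haarMeanEntanglingPower]
  simp only [entanglingPower_eq_trace hN, ← RCLike.re_to_complex]
  have hre := integral_re hint
  rw [hmean] at hre
  rw [integral_sub (integrable_const _) hint.re, hre]
  have : (N : ℝ) ^ 2 + 1 ≠ 0 := by positivity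
  simp only [integral_const, probReal_univ, smul_eq_mul, RCLike.re_to_complex, Complex.ofReal_re]
  field_simp
  ring

end MeanEntropy

/-! ### Interlaced products and multiplicativity. -/

section Interlaced

variable {N : ℕ}

instance (m : ℕ) : IsProbabilityMeasure (localHaar N m) := by
  unfold localHaar
  infer_instance

theorem interlaced_mem_unitaryGroup {U : Matrix (Fin N × Fin N) (Fin N × Fin N) ℂ}
    (hU : U ∈ unitaryGroup (Fin N × Fin N) ℂ) (m : ℕ)
    (w : Fin m → unitaryGroup (Fin N) ℂ × unitaryGroup (Fin N) ℂ) :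
    interlaced U m w ∈ unitaryGroup (Fin N × Fin N) ℂ := by
  induction m with
  | zero => exact hU
  | succ m ih => exact mul_mem (mul_mem hU (localGate_mem_unitaryGroup _)) (ih _)

theorem continuous_interlaced (U : Matrix (Fin N × Fin N) (Fin N × Fin N) ℂ) (m : ℕ) :
    Continuous (interlaced U m) := by
  induction m with
  | zero => exact continuous_const
  | succ m ih =>
    exact (continuous_const.matrix_mul (continuous_localGate.comp (continuous_apply _))).matrix_mul
      (ih.comp (continuous_pi fun j => continuous_apply _))

theorem integrable_comp_interlaced {f : Matrix (Fin N × Fin N) (Fin N × Fin N) ℂ → ℝ}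
    (hf : Continuous f) (U : Matrix (Fin N × Fin N) (Fin N × Fin N) ℂ) (m : ℕ) :
    Integrable (fun w => f (interlaced U m w)) (localHaar N m) :=
  integrable_of_continuous_compactSpace _ (hf.comp (continuous_interlaced U m))

/-- A function that is multiplicative on average under a random local gate is multiplicative on
average along the interlaced product. -/
theorem integral_comp_interlaced {f : Matrix (Fin N × Fin N) (Fin N × Fin N) ℂ → ℝ}
    (hf : Continuous f)
    (hmul : ∀ U ∈ unitaryGroup (Fin N × Fin N) ℂ, ∀ V ∈ unitaryGroup (Fin N × Fin N) ℂ,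
      ∫ w, f (U * localGate w * V) ∂(haarU (Fin N)).prod (haarU (Fin N)) = f U * f V)
    {U : Matrix (Fin N × Fin N) (Fin N × Fin N) ℂ} (hU : U ∈ unitaryGroup (Fin N × Fin N) ℂ)
    (m : ℕ) : ∫ w, f (interlaced U m w) ∂localHaar N m = f U ^ (m + 1) := by
  induction m with
  | zero => simp [interlaced]
  | succ m ih =>
    -- The last local gate, next to the leftmost `U`, is split off. It is integrated first, with the
    -- unitary formed by the remaining gates held fixed, so `hmul` applies.
    have hmp := measurePreserving_piFinSuccAbove
      (fun _ : Fin (m + 1) => (haarU (Fin N)).prod (haarU (Fin N))) (Fin.last m)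
    let G : (unitaryGroup (Fin N) ℂ × unitaryGroup (Fin N) ℂ) ×
        (Fin m → unitaryGroup (Fin N) ℂ × unitaryGroup (Fin N) ℂ) → ℝ :=
      fun z => f (U * localGate z.1 * interlaced U m z.2)
    have hG : Integrable G
        (((haarU (Fin N)).prod (haarU (Fin N))).prod (localHaar N m)) :=
      integrable_of_continuous_compactSpace _ (hf.comp
        ((continuous_const.matrix_mul (continuous_localGate.comp continuous_fst)).matrix_mul
          ((continuous_interlaced U m).comp continuous_snd)))
    have h1 : ∫ w, f (interlaced U (m + 1) w) ∂localHaar N (m + 1) =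
        ∫ z, G z ∂((haarU (Fin N)).prod (haarU (Fin N))).prod (localHaar N m) := by
      rw [localHaar, localHaar, ← hmp.integral_comp' (g := G)]
      refine integral_congr_ae (.of_forall fun w => ?_)
      simp only [G, MeasurableEquiv.piFinSuccAbove_apply, Fin.insertNthEquiv_symm_apply,
        Fin.removeNth_last, interlaced]
      rfl
    rw [h1, integral_prod_symm _ hG]
    simp only [G, hmul U hU _ (interlaced_mem_unitaryGroup hU m _)]
    rw [integral_const_mul, ih]
    ring

/-- The antisymmetric sector, `ε = -1`, with eigenvector `A - B`. -/
theorem integral_one_sub_gateTypicality (hN : 2 ≤ N)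
    {U V : Matrix (Fin N × Fin N) (Fin N × Fin N) ℂ}
    (hV : V ∈ unitaryGroup (Fin N × Fin N) ℂ) :
    ∫ w, (1 - gateTypicality (U * localGate w * V)) ∂(haarU (Fin N)).prod (haarU (Fin N)) =
      (1 - gateTypicality U) * (1 - gateTypicality V) := by
  have h2 : (2 : ℝ) ≤ N := by exact_mod_cast hN
  have hA : trace (exchFst N * (exchFst N - exchSnd N)) = (N : ℂ) ^ 4 - (N : ℂ) ^ 2 := by
    rw [Matrix.mul_sub, trace_sub, exchFst_mul_exchFst, exchFst_mul_exchSnd, trace_one_two_copies,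
      trace_exchBoth]
  have hA0 : trace (exchFst N * (exchFst N - exchSnd N)) ≠ 0 := by
    have : (N : ℝ) ^ 4 - (N : ℝ) ^ 2 ≠ 0 := by
      have h3 : (N : ℝ) ^ 4 - (N : ℝ) ^ 2 = (N : ℝ) ^ 2 * (((N : ℝ) - 1) * ((N : ℝ) + 1)) := by
        ring
      have h4 : 0 < (N : ℝ) - 1 := by linarith
      rw [h3]
      positivity
    rw [hA]
    exact_mod_cast this
  have h0 : trace (exchFst N - exchSnd N) = 0 := by
    rw [trace_sub, trace_exchFst, trace_exchSnd, sub_self]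
  have hF : (exchFst N - exchSnd N) * exchBoth N = (-1 : ℂ) • (exchFst N - exchSnd N) := by
    rw [Matrix.sub_mul, exchFst_mul_exchBoth, exchSnd_mul_exchBoth]
    module
  have hg : ∀ W : Matrix (Fin N × Fin N) (Fin N × Fin N) ℂ,
      trace (exchFst N * twoCopy W (exchFst N - exchSnd N)) /
        trace (exchFst N * (exchFst N - exchSnd N)) = ((1 - gateTypicality W : ℝ) : ℂ) := by
    intro W
    rw [one_sub_gateTypicality hN, hA, twoCopy_sub, Matrix.mul_sub, trace_sub,
      ← ofReal_schmidtSum, ← ofReal_schmidtSum_mul_swapGate]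
    push_cast
    rfl
  have := integral_trace_twoCopy_mul_localGate_mul hN
    (⟨0, 1, -1, 0, by module⟩ : IsLocalCombination (exchFst N - exchSnd N)) hF h0 hA0 U hV
  simp only [hg] at this
  rw [integral_complex_ofReal] at this
  exact_mod_cast this

/-- The symmetric sector, `ε = 1`. -/
theorem integral_one_sub_entanglingPower_div (hN : 2 ≤ N)
    {U V : Matrix (Fin N × Fin N) (Fin N × Fin N) ℂ}
    (hU : U ∈ unitaryGroup (Fin N × Fin N) ℂ) (hV : V ∈ unitaryGroup (Fin N × Fin N) ℂ) :
    ∫ w, (1 - entanglingPower (U * localGate w * V) / haarMeanEntanglingPower N)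
        ∂(haarU (Fin N)).prod (haarU (Fin N)) =
      (1 - entanglingPower U / haarMeanEntanglingPower N) *
        (1 - entanglingPower V / haarMeanEntanglingPower N) := by
  have h2 : (2 : ℝ) ≤ N := by exact_mod_cast hN
  have r0 : (N : ℝ) ≠ 0 := by positivity
  have r1 : (N : ℝ) - 1 ≠ 0 := by linarith
  have r2 : (N : ℝ) + 1 ≠ 0 := by positivity
  have r3 : (N : ℝ) ^ 2 + 1 ≠ 0 := by positivity
  have n3 : (N : ℂ) ^ 2 + 1 ≠ 0 := by exact_mod_cast r3
  -- The value making `Z` traceless: `tr (A + B) = 2N³` and `tr (1 + F) = N⁴ + N²`.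
  set κ : ℂ := 2 * N / ((N : ℂ) ^ 2 + 1) with hκ
  set Z := exchFst N + exchSnd N - κ • (1 + exchBoth N) with hZ
  have hA : trace (exchFst N * Z) =
      (((N : ℝ) ^ 2 * (((N : ℝ) + 1) * ((N : ℝ) - 1)) ^ 2 / ((N : ℝ) ^ 2 + 1) : ℝ) : ℂ) := by
    simp only [hZ, Matrix.mul_sub, Matrix.mul_add, Matrix.mul_smul, Matrix.mul_one, trace_sub,
      trace_add, trace_smul, smul_eq_mul, exchFst_mul_exchFst, exchFst_mul_exchSnd,
      exchFst_mul_exchBoth, trace_one_two_copies, trace_exchBoth, trace_exchFst, trace_exchSnd, hκ]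
    push_cast
    field_simp
    ring
  have hA0 : trace (exchFst N * Z) ≠ 0 := by
    rw [hA]
    exact_mod_cast div_ne_zero (mul_ne_zero (pow_ne_zero 2 r0)
      (pow_ne_zero 2 (mul_ne_zero r2 r1))) r3
  have h0 : trace Z = 0 := by
    simp only [hZ, trace_sub, trace_add, trace_smul, smul_eq_mul, trace_one_two_copies,
      trace_exchBoth, trace_exchFst, trace_exchSnd, hκ]
    field_simp
    ring
  have hF : Z * exchBoth N = (1 : ℂ) • Z := by
    simp only [hZ, Matrix.sub_mul, Matrix.add_mul, Matrix.smul_mul, Matrix.one_mul,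
      exchFst_mul_exchBoth, exchSnd_mul_exchBoth, exchBoth_mul_exchBoth]
    module
  have hg : ∀ W ∈ unitaryGroup (Fin N × Fin N) ℂ,
      trace (exchFst N * twoCopy W Z) / trace (exchFst N * Z) =
        ((1 - entanglingPower W / haarMeanEntanglingPower N : ℝ) : ℂ) := by
    intro W hW
    have hT : trace (exchFst N * twoCopy W Z) = ((schmidtSum W + schmidtSum (W * swapGate N) -
        2 * (N : ℝ) / ((N : ℝ) ^ 2 + 1) * (2 * (N : ℝ) ^ 3) : ℝ) : ℂ) := by
      push_cast
      rw [ofReal_schmidtSum_mul_swapGate]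
      simp only [hZ, twoCopy_sub, twoCopy_add, twoCopy_smul, twoCopy_one_of_mem hW,
        twoCopy_exchBoth_of_mem hW, Matrix.mul_sub, Matrix.mul_add, Matrix.mul_smul,
        Matrix.mul_one, trace_sub, trace_add, trace_smul, smul_eq_mul, exchFst_mul_exchBoth,
        trace_exchFst, trace_exchSnd, ofReal_schmidtSum, hκ]
      ring
    rw [hA, hT, entanglingPower_eq hN hW, haarMeanEntanglingPower_eq hN]
    norm_cast
    push_cast
    field_simp
    ring
  have := integral_trace_twoCopy_mul_localGate_mul hN
    (⟨-κ, 1, 1, -κ, by module⟩ : IsLocalCombination Z) hF h0 hA0 U hV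
  rw [hg U hU, hg V hV] at this
  simp only [fun w => hg _ (mul_mem (mul_mem hU (localGate_mem_unitaryGroup w)) hV)] at this
  rw [integral_complex_ofReal] at this
  exact_mod_cast this

theorem continuous_gateTypicality : Continuous (gateTypicality (N := N)) := by
  have hE : Continuous (operatorEntanglement (N := N)) :=
    continuous_const.sub (continuous_const.mul continuous_schmidtSum)
  exact continuous_const.mul ((hE.sub (hE.comp (continuous_id.matrix_mul continuous_const))).add
    continuous_const)

end Interlaced

end

end BipartiteGate

/-! ### The theorem. -/

open BipartiteGate
theorem theorem1 (N : ℕ) (hN : 2 ≤ N) (U : Matrix (Fin N × Fin N) (Fin N × Fin N) ℂ)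
    (hU : U ∈ Matrix.unitaryGroup (Fin N × Fin N) ℂ) (n : ℕ) (hn : 1 ≤ n) :
    haarMeanEntanglingPower N = ((N : ℝ) - 1) ^ 2 / ((N : ℝ) ^ 2 + 1) ∧
    MeasureTheory.Integrable (fun w => entanglingPower (interlaced U (n - 1) w))
      (localHaar N (n - 1)) ∧
    MeasureTheory.Integrable (fun w => gateTypicality (interlaced U (n - 1) w))
      (localHaar N (n - 1)) ∧
    ∫ w, entanglingPower (interlaced U (n - 1) w) ∂localHaar N (n - 1) =
      haarMeanEntanglingPower N *
        (1 - (1 - entanglingPower U / haarMeanEntanglingPower N) ^ n) ∧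
    ∫ w, gateTypicality (interlaced U (n - 1) w) ∂localHaar N (n - 1) =
      1 - (1 - gateTypicality U) ^ n := by
  have hmean := haarMeanEntanglingPower_eq hN
  have hmean0 : haarMeanEntanglingPower N ≠ 0 := by
    have h2 : (2 : ℝ) ≤ N := by exact_mod_cast hN
    rw [hmean]
    exact div_ne_zero (pow_ne_zero 2 (by linarith)) (by positivity)
  have hie := integrable_comp_interlaced (continuous_entanglingPower hN) U (n - 1)
  have hig := integrable_comp_interlaced continuous_gateTypicality U (n - 1)
  refine ⟨hmean, hie, hig, ?_, ?_⟩
  -- The `n - 1` local gates separate `n` copies of `U`, which accounts for the exponent `n`.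
  · have h := integral_comp_interlaced
      (f := fun V => 1 - entanglingPower V / haarMeanEntanglingPower N)
      (continuous_const.sub ((continuous_entanglingPower hN).div_const _))
      (fun U hU V hV => integral_one_sub_entanglingPower_div hN hU hV) hU (n - 1)
    rw [Nat.sub_add_cancel hn, integral_sub (integrable_const _) (hie.div_const _),
      integral_div] at h
    simp only [integral_const, probReal_univ, smul_eq_mul, mul_one] at h
    rw [← h]
    field_simp
    ring
  · have h := integral_comp_interlaced (f := fun V => 1 - gateTypicality V)
      (continuous_const.sub continuous_gateTypicality)
      (fun U _ V hV => integral_one_sub_gateTypicality hN hV) hU (n - 1)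
    rw [Nat.sub_add_cancel hn, integral_sub (integrable_const _) hig] at h
    simp only [integral_const, probReal_univ, smul_eq_mul, mul_one] at h
    linarith
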